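/- **Definitions.** An $[n,k,d]_q$ code is a linear code $\mathcal C\subseteq\mathbb F_q^n$ of dimension $k$ and minimum distance $d$. For $S\subseteq[n]$ let $\mathcal C|_S$ be the code obtained by deleting all symbols outside $S$. The $i$-th symbol of $\mathcal C$ has $(r,\delta)$-locality if there is $S\subseteq[n]$ with $i\in S$, $|S|\le r+\delta-1$, such that $\mathcal C|_S$ has minimum distance at least $\delta$ (every nonzero word has weight at least $\delta$). $\mathcal C$ has information $(r,\delta)$-locality if there is a $k$-set $I\subseteq[n]$ with $\dim \mathcal C|_I=k$ such that for every $i\in I$ the $i$-th symbol has $(r,\delta)$-locality. An optimal $[n,k,d;(r,\delta)_i]$-LRC over $\mathbb F_q$ is an $[n,k,d]_q$ code with $k\ge 1$ and information $(r,\delta)$-locality for which $$d=n-k+1-\left(\left\lceil \tfrac kr\right\rceil-1\right)(\delta-1).$$ A family of codes, one over each field with $q$ elements for $q$ large, is explicit if one deterministic program, given $q$, computes a parity-check matrix of the code (its size and all its entries) in a number of steps polynomial in $q$. Here a program handles non-negative integers, and elements of $\mathbb F_q$ through their numbers $0,\dots,q-1$ in an arbitrary enumeration of $\mathbb F_q$;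 its instructions, of one step each, are zero, successor, access to an input, the constants $0,1$ of $\mathbb F_q$ and the operations $+,-,\cdot$ of $\mathbb F_q$; programs are combined by composition and by loops whose number of passes is the value of a variable, where each composition and each pass costs one step in addition to the steps of the programs called. **Theorem.** Let $r\ge 1$, $\delta\ge 2$ and $h$ be integers with $2\delta+1\le h\le 3\delta$, and let $R=r+\delta-1$. Then there is an explicit family, over all finite fields $\mathbb F_q$ with $q\ge q_0(r,\delta,h)$, of optimal $[n,k,h+\delta;(r,\delta)_i]$-LRCs whose length is $$n=\begin{cases} R\,q^{\frac{\delta}{2}+1-o(1)}, & \delta \text{ even},\\[2pt] R\,q^{\frac{\delta+1}{2}-o(1)}, & \delta\text{ odd},\end{cases}$$ where $o(1)$ denotes a function of $q$ (which may depend on $r,\delta,h$) that tends to $0$ as $q\to\infty$. The same program serves for all these fields and all their enumerations, and the length depends only on $q$ (and $r,\delta,h$). -/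

import Mathlib

open Filter Topology

namespace LRC

section Codes

variable {F : Type*} [Field F] {ι : Type*} [Fintype ι]

/-- The minimum distance of the linear code `C` is at least `d`: every nonzero codeword has
Hamming weight at least `d`. -/
def MinDistGE (C : Submodule F (ι → F)) (d : ℕ) : Prop :=
  open Classical in ∀ c ∈ C, c ≠ 0 → d ≤ hammingNorm c

/-- The minimum distance of the linear code `C` equals `d`: the least Hamming weight of a nonzero
codeword exists and is `d`. -/
def IsMinDist (C : Submodule F (ι → F)) (d : ℕ) : Prop :=
  open Classical in IsLeast {w : ℕ | ∃ c ∈ C, c ≠ 0 ∧ hammingNorm c = w} d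

/-- The code `C|_S` obtained from `C` by deleting all symbols with index outside `S`. -/
def restrict (C : Submodule F (ι → F)) (S : Finset ι) : Submodule F (S → F) :=
  C.map (LinearMap.funLeft F F (Subtype.val : S → ι))

/-- The symbol with index `i` of the code `C` has `(r, δ)`-locality. -/
def HasLocality (C : Submodule F (ι → F)) (r δ : ℕ) (i : ι) : Prop :=
  ∃ S : Finset ι, i ∈ S ∧ S.card ≤ r + δ - 1 ∧ MinDistGE (restrict C S) δ

/-- The code `C` has information `(r, δ)`-locality: there is an information set `I` (as many
indices as the dimension of `C`, on which `C` has full rank) all of whose symbols have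
`(r, δ)`-locality. -/
def HasInfoLocality (C : Submodule F (ι → F)) (r δ : ℕ) : Prop :=
  ∃ I : Finset ι, I.card = Module.finrank F C ∧
    Module.finrank F (restrict C I) = Module.finrank F C ∧
    ∀ i ∈ I, HasLocality C r δ i

/-- `C` is an optimal `[n, k, d; (r, δ)_i]`-LRC: a linear code of length `n`, dimension `k ≥ 1`
and minimum distance `d` with information `(r, δ)`-locality that attains the Singleton-type bound
`d ≤ n - k + 1 - (⌈k / r⌉ - 1) (δ - 1)` with equality. -/
def IsOptimalInfoLRC {n : ℕ} (C : Submodule F (Fin n → F)) (k d r δ : ℕ) : Prop :=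
  1 ≤ k ∧ Module.finrank F C = k ∧ IsMinDist C d ∧ HasInfoLocality C r δ ∧
    (d : ℤ) = (n : ℤ) - k + 1 - (⌈(k : ℚ) / (r : ℚ)⌉ - 1) * ((δ : ℤ) - 1)

end Codes

section Algorithms

/-- Programs over a finite field with `n` natural-number inputs and one natural-number output.
Field elements are handled through their numbers `0, …, q - 1` in a given enumeration of the field.
The counting instructions are zero, successor, and access to an input; the field instructions are
the constants `0`, `1` and the operations `+`, `-` and `*` of the field; programs are combined by
composition and by loops (primitive recursion on the first input). -/
inductive Prog : ℕ → Type
  | zero {n : ℕ} : Prog n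
  | succ : Prog 1
  | input {n : ℕ} (i : Fin n) : Prog n
  | fzero {n : ℕ} : Prog n
  | fone {n : ℕ} : Prog n
  | fadd : Prog 2
  | fneg : Prog 1
  | fmul : Prog 2
  | comp {m n : ℕ} (f : Prog m) (g : Fin m → Prog n) : Prog n
  | loop {n : ℕ} (f : Prog n) (g : Prog (n + 2)) : Prog (n + 1)

variable {F : Type*} [Field F] {q : ℕ}

/-- The field element with number `x` (and `0` if `x` is not the number of a field element). -/
def elt (enum : Fin q ≃ F) (x : ℕ) : F :=
  if hx : x < q then enum ⟨x, hx⟩ else 0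

/-- The number of a field element. -/
def idx (enum : Fin q ≃ F) (a : F) : ℕ := (enum.symm a : ℕ)

/-- The output of a program. The program `loop f g` on input `(N, x)` starts with the value `f x`
and replaces, for `i = 0, …, N - 1`, the current value `y` by `g (i, y, x)`. -/
def Prog.eval (enum : Fin q ≃ F) : {n : ℕ} → Prog n → (Fin n → ℕ) → ℕ
  | _, .zero, _ => 0
  | _, .succ, x => x 0 + 1
  | _, .input i, x => x i
  | _, .fzero, _ => idx enum 0
  | _, .fone, _ => idx enum 1
  | _, .fadd, x => idx enum (elt enum (x 0) + elt enum (x 1))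
  | _, .fneg, x => idx enum (-elt enum (x 0))
  | _, .fmul, x => idx enum (elt enum (x 0) * elt enum (x 1))
  | _, .comp f g, x => f.eval enum (fun j => (g j).eval enum x)
  | _, .loop f g, x =>
      Nat.rec (f.eval enum (Fin.tail x))
        (fun i y => g.eval enum (Fin.cons i (Fin.cons y (Fin.tail x)))) (x 0)

/-- The number of steps that a program makes. Every instruction, every composition and every pass
through a loop costs one step, in addition to the steps of all the programs called. -/
def Prog.steps (enum : Fin q ≃ F) : {n : ℕ} → Prog n → (Fin n → ℕ) → ℕ
  | _, .zero, _ => 1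
  | _, .succ, _ => 1
  | _, .input _, _ => 1
  | _, .fzero, _ => 1
  | _, .fone, _ => 1
  | _, .fadd, _ => 1
  | _, .fneg, _ => 1
  | _, .fmul, _ => 1
  | _, .comp f g, x =>
      1 + ∑ j, (g j).steps enum x + f.steps enum (fun j => (g j).eval enum x)
  | _, .loop f g, x =>
      1 + f.steps enum (Fin.tail x) +
        ∑ i ∈ Finset.range (x 0),
          (1 + g.steps enum (Fin.cons i (Fin.cons
            ((Prog.loop f g).eval enum (Fin.cons i (Fin.tail x))) (Fin.tail x))))

/-- A uniform description of a matrix over every finite field: on input `q`, the programs `rows`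
and `cols` give the size of the matrix, and on input `(q, a, b)` the program `entry` gives the
number of the field element in row `a` and column `b`. -/
structure MatrixAlgorithm where
  rows : Prog 1
  cols : Prog 1
  entry : Prog 3

namespace MatrixAlgorithm

/-- The number of rows of the matrix produced over a field with `q` elements. -/
def numRows (A : MatrixAlgorithm) (enum : Fin q ≃ F) : ℕ := A.rows.eval enum ![q]

/-- The number of columns of the matrix produced over a field with `q` elements. -/
def numCols (A : MatrixAlgorithm) (enum : Fin q ≃ F) : ℕ := A.cols.eval enum ![q]

/-- The matrix produced over a field with `q` elements. -/
def matrix (A : MatrixAlgorithm) (enum : Fin q ≃ F) :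
    Matrix (Fin (A.numRows enum)) (Fin (A.numCols enum)) F :=
  Matrix.of fun a b => elt enum (A.entry.eval enum ![q, a, b])

/-- The linear code whose parity-check matrix is the matrix produced. -/
def code (A : MatrixAlgorithm) (enum : Fin q ≃ F) :
    Submodule F (Fin (A.numCols enum) → F) :=
  LinearMap.ker (A.matrix enum).mulVecLin

/-- The total number of steps for producing the whole matrix: its size and all its entries. -/
def totalSteps (A : MatrixAlgorithm) (enum : Fin q ≃ F) : ℕ :=
  A.rows.steps enum ![q] + A.cols.steps enum ![q] +
    ∑ a : Fin (A.numRows enum), ∑ b : Fin (A.numCols enum), A.entry.steps enum ![q, a, b]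

/-- Every entry output is the number of a field element. -/
def Valid (A : MatrixAlgorithm) (enum : Fin q ≃ F) : Prop :=
  ∀ (a : Fin (A.numRows enum)) (b : Fin (A.numCols enum)), A.entry.eval enum ![q, a, b] < q

end MatrixAlgorithm

end Algorithms

/-- The exponent of `q` in the length, up to a term `o(1)`. -/
noncomputable def lengthExponent (δ : ℕ) : ℝ :=
  if Even δ then (δ : ℝ) / 2 + 1 else ((δ : ℝ) + 1) / 2

end LRC

/-! Each of ℓ local groups has R = r + δ - 1 symbols, and each of these symbols carries a field
element, its point. Inside a group δ - 1 power sums vanish, so the group has distance at least δ; h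
global parities are formed with the functions 1 / (x - z) for h poles z. Points of different groups
may coincide, and this is how the length gets beyond q.

For the distance, add up the local symbols of a word over each point. If the resulting function u is
nonzero, it is orthogonal to δ - 1 powers and to the functions 1 / (x - z) of the vanishing global
symbols; such functions form an MDS system (`add_card_lt_card_support`), and the weight is at least
h + δ. If u = 0, every nonzero local symbol shares its point with one of another group. Four nonzero
groups already have weight 4δ ≥ h + δ, so it remains to choose the points such that at most three
groups never cover subsets of size at least δ twice (`GroupData.IsWord.le_hammingNorm`).

To this end the groups are graphs of integer polynomials of degree at most m = ⌊δ/2⌋ on 0, …, R - 1.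
Two graphs share at most m < δ points. Three bad graphs force δ = 2m and disjoint agreement sets of
size exactly m; comparing the factorizations of the differences gives c₁(a₁ - a₂) + c₃(a₃ - a₂) = 0
for the leading coefficients, with |c₁|, |c₃| ≤ R^m (`false_of_disjoint_agree`). The leading
coefficients come from a Behrend-type set: points (x, |x|²) of a paraboloid, read as digits. Since a
line meets a paraboloid at most twice, the relation is impossible (`eq_of_paraboloid_relation`).
With w = ⌊√(log₂ q)⌋ digit size and dimension, this costs only a factor 2^O(w) = q^o(1), and there
remain q^(m+1-o(1)) groups.

The points are given by integers below q, so any enumeration of the field serves. The entries are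
computed by functions in the class `PolyTime`, which is closed under the arithmetic needed. -/

namespace LRC

universe u

/-- A finite field together with an enumeration of its elements. -/
structure FieldEnum : Type (u + 1) where
  q : ℕ
  F : Type u
  [field : Field F]
  enum : Fin q ≃ F

attribute [instance] FieldEnum.field

theorem idx_lt {F : Type*} [Field F] {q : ℕ} (enum : Fin q ≃ F) (a : F) : idx enum a < q :=
  (enum.symm a).isLt

@[simp]
theorem elt_idx {F : Type*} [Field F] {q : ℕ} (enum : Fin q ≃ F) (a : F) :
    elt enum (idx enum a) = a := by
  simp [elt, idx]

/-- The size of an input of a program. -/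
def size (Γ : FieldEnum.{u}) {n : ℕ} (x : Fin n → ℕ) : ℕ := Γ.q + ∑ i, x i + 2

/-! ### Growth rates: bounds polynomial in the size of the input. -/

section PolyBdd

variable {n m : ℕ}

/-- The function `f` is bounded by a polynomial in the size of the input. -/
def PolyBdd (f : FieldEnum.{u} → (Fin n → ℕ) → ℕ) : Prop :=
  ∃ K, ∀ Γ x, f Γ x ≤ size Γ x ^ K

theorem two_le_size (Γ : FieldEnum.{u}) (x : Fin n → ℕ) : 2 ≤ size Γ x := by
  unfold size; omega

theorem le_size (Γ : FieldEnum.{u}) (x : Fin n → ℕ) (i : Fin n) : x i ≤ size Γ x := by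
  have := Finset.single_le_sum (f := x) (fun j _ => Nat.zero_le _) (Finset.mem_univ i)
  unfold size; omega

theorem PolyBdd.mono {f g : FieldEnum.{u} → (Fin n → ℕ) → ℕ} (hg : PolyBdd g)
    (h : ∀ Γ x, f Γ x ≤ g Γ x) : PolyBdd f := by
  obtain ⟨K, hK⟩ := hg
  exact ⟨K, fun Γ x => (h Γ x).trans (hK Γ x)⟩

theorem PolyBdd.size : PolyBdd (fun Γ (x : Fin n → ℕ) => size Γ x) :=
  ⟨1, fun Γ x => by simp⟩

theorem PolyBdd.const (c : ℕ) : PolyBdd (fun (_ : FieldEnum.{u}) (_ : Fin n → ℕ) => c) :=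
  ⟨c, fun Γ x => (Nat.lt_two_pow_self.le).trans (Nat.pow_le_pow_left (two_le_size Γ x) c)⟩

theorem PolyBdd.mul {f g : FieldEnum.{u} → (Fin n → ℕ) → ℕ} (hf : PolyBdd f) (hg : PolyBdd g) :
    PolyBdd (fun Γ x => f Γ x * g Γ x) := by
  obtain ⟨K, hK⟩ := hf
  obtain ⟨L, hL⟩ := hg
  exact ⟨K + L, fun Γ x => by rw [pow_add]; exact Nat.mul_le_mul (hK Γ x) (hL Γ x)⟩

theorem PolyBdd.add {f g : FieldEnum.{u} → (Fin n → ℕ) → ℕ} (hf : PolyBdd f) (hg : PolyBdd g) :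
    PolyBdd (fun Γ x => f Γ x + g Γ x) := by
  have h : PolyBdd (fun Γ x => (f Γ x + 1) * (g Γ x + 1)) := by
    have succ : ∀ {f : FieldEnum.{u} → (Fin n → ℕ) → ℕ}, PolyBdd f →
        PolyBdd (fun Γ x => f Γ x + 1) := by
      rintro f ⟨K, hK⟩
      refine ⟨K + 1, fun Γ x => ?_⟩
      have h1 := Nat.one_le_pow K (LRC.size Γ x) (by have := two_le_size Γ x; omega)
      have h2 := two_le_size Γ x
      calc f Γ x + 1 ≤ LRC.size Γ x ^ K * 2 := by have := hK Γ x; omega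
        _ ≤ _ := by rw [pow_succ]; exact Nat.mul_le_mul_left _ h2
    exact (succ hf).mul (succ hg)
  exact h.mono fun Γ x => by nlinarith [Nat.zero_le (f Γ x * g Γ x)]

theorem PolyBdd.pow {f : FieldEnum.{u} → (Fin n → ℕ) → ℕ} (hf : PolyBdd f) (k : ℕ) :
    PolyBdd (fun Γ x => f Γ x ^ k) := by
  obtain ⟨K, hK⟩ := hf
  exact ⟨K * k, fun Γ x => by rw [pow_mul]; exact Nat.pow_le_pow_left (hK Γ x) k⟩

theorem PolyBdd.sum {ι : Type*} (s : Finset ι) {f : ι → FieldEnum.{u} → (Fin n → ℕ) → ℕ}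
    (hf : ∀ i, PolyBdd (f i)) : PolyBdd (fun Γ x => ∑ i ∈ s, f i Γ x) := by
  classical
  induction s using Finset.induction_on with
  | empty => simpa using PolyBdd.const 0
  | insert a s ha ih =>
    simp only [Finset.sum_insert ha]
    exact (hf a).add ih

theorem PolyBdd.q : PolyBdd (fun (Γ : FieldEnum.{u}) (_ : Fin n → ℕ) => Γ.q) :=
  PolyBdd.size.mono fun Γ x => by unfold LRC.size; omega

theorem PolyBdd.input (i : Fin n) : PolyBdd (fun (_ : FieldEnum.{u}) (x : Fin n → ℕ) => x i) :=
  PolyBdd.size.mono fun Γ x => le_size Γ x i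

theorem PolyBdd.comp {f : FieldEnum.{u} → (Fin m → ℕ) → ℕ}
    {g : Fin m → FieldEnum.{u} → (Fin n → ℕ) → ℕ} (hf : PolyBdd f) (hg : ∀ j, PolyBdd (g j)) :
    PolyBdd (fun Γ x => f Γ (fun j => g j Γ x)) := by
  obtain ⟨K, hK⟩ := hf
  exact (((PolyBdd.q.add (PolyBdd.sum Finset.univ hg)).add (PolyBdd.const 2)).pow K).mono
    fun Γ x => hK Γ _

end PolyBdd

/-- The output of a program exceeds the inputs and the size of the field by at most the number of
steps. -/
theorem Prog.eval_le_add_steps {F : Type*} [Field F] {q : ℕ} (enum : Fin q ≃ F) {n : ℕ}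
    (P : Prog n) (x : Fin n → ℕ) (B : ℕ) (hq : q ≤ B) (hx : ∀ i, x i ≤ B) :
    P.eval enum x ≤ B + P.steps enum x := by
  induction P generalizing B with
  | zero => simp [Prog.eval]
  | succ => simpa [Prog.eval, Prog.steps] using hx 0
  | input i => exact (hx i).trans (Nat.le_add_right _ _)
  | fzero => exact (idx_lt enum _).le.trans (hq.trans (Nat.le_add_right _ _))
  | fone => exact (idx_lt enum _).le.trans (hq.trans (Nat.le_add_right _ _))
  | fadd => exact (idx_lt enum _).le.trans (hq.trans (Nat.le_add_right _ _))
  | fneg => exact (idx_lt enum _).le.trans (hq.trans (Nat.le_add_right _ _))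
  | fmul => exact (idx_lt enum _).le.trans (hq.trans (Nat.le_add_right _ _))
  | comp f g ihf ihg =>
    simp only [Prog.eval, Prog.steps]
    have h := ihf (fun j => (g j).eval enum x) (B + ∑ j, (g j).steps enum x) (by omega)
      (fun j => (ihg j x B hq hx).trans (Nat.add_le_add_left
        (Finset.single_le_sum (f := fun j => (g j).steps enum x) (fun j _ => Nat.zero_le _)
          (Finset.mem_univ j)) B))
    omega
  | loop f g ihf ihg =>
    obtain ⟨N, t, rfl⟩ : ∃ N t, x = Fin.cons N t := ⟨x 0, Fin.tail x, (Fin.cons_self_tail x).symm⟩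
    have ht : ∀ i, t i ≤ B := fun i => by simpa using hx i.succ
    have hN : N ≤ B := by simpa using hx 0
    clear hx
    induction N with
    | zero =>
      have := ihf t B hq ht
      simp only [Prog.eval, Prog.steps, Fin.cons_zero, Fin.tail_cons]
      simp only [Finset.range_zero, Finset.sum_empty]
      change f.eval enum t ≤ _
      omega
    | succ N ih =>
      have h := ih (by omega)
      have h2 := ihg (Fin.cons N (Fin.cons ((Prog.loop f g).eval enum (Fin.cons N t)) t))
        (B + (Prog.loop f g).steps enum (Fin.cons N t)) (by omega) (by
          intro i
          refine Fin.cases ?_ (fun i => Fin.cases ?_ (fun i => ?_) i) i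
          · simp; omega
          · simpa using h
          · simpa using (ht i).trans (Nat.le_add_right _ _))
      have e1 : (Prog.loop f g).eval enum (Fin.cons (N + 1) t) =
          g.eval enum (Fin.cons N (Fin.cons ((Prog.loop f g).eval enum (Fin.cons N t)) t)) := rfl
      have e2 : (Prog.loop f g).steps enum (Fin.cons (N + 1) t) =
          (Prog.loop f g).steps enum (Fin.cons N t) + (1 + g.steps enum
            (Fin.cons N (Fin.cons ((Prog.loop f g).eval enum (Fin.cons N t)) t))) := by
        conv_lhs => unfold Prog.steps
        conv_rhs => enter [1]; unfold Prog.steps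
        simp only [Fin.cons_zero, Fin.tail_cons, Finset.sum_range_succ]
        omega
      rw [e1, e2]
      omega

/-! ### Arithmetic in polynomial time. -/

section PolyTime

variable {n m : ℕ}

/-- The function `f` is computed by one program over all enumerated finite fields, within a number
of steps that is polynomial in the size of the input. -/
def PolyTime (f : FieldEnum.{u} → (Fin n → ℕ) → ℕ) : Prop :=
  ∃ P : Prog n, (∀ Γ x, P.eval Γ.enum x = f Γ x) ∧
    PolyBdd fun (Γ : FieldEnum.{u}) x => P.steps Γ.enum x

/-- A value beyond the inputs and q has to be built up step by step. This is what makes composition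
work: the inner values remain polynomial, hence so does the running time of the outer program. -/
theorem PolyTime.polyBdd {f : FieldEnum.{u} → (Fin n → ℕ) → ℕ} (hf : PolyTime f) : PolyBdd f := by
  obtain ⟨P, hP, hs⟩ := hf
  exact (PolyBdd.size.add hs).mono fun Γ x => by
    rw [← hP]
    exact P.eval_le_add_steps Γ.enum x _ (by unfold size; omega) (le_size Γ x)

theorem PolyTime.of_eq {f g : FieldEnum.{u} → (Fin n → ℕ) → ℕ} (hf : PolyTime f)
    (h : ∀ Γ x, f Γ x = g Γ x) : PolyTime g := by
  obtain rfl : f = g := by funext Γ x; exact h Γ x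
  exact hf

theorem PolyTime.comp {f : FieldEnum.{u} → (Fin m → ℕ) → ℕ}
    {g : Fin m → FieldEnum.{u} → (Fin n → ℕ) → ℕ} (hf : PolyTime f) (hg : ∀ j, PolyTime (g j)) :
    PolyTime (fun Γ x => f Γ (fun j => g j Γ x)) := by
  have hgb := fun j => (hg j).polyBdd
  obtain ⟨P, hP, hs⟩ := hf
  choose Q hQ ht using hg
  refine ⟨.comp P Q, fun Γ x => by simp only [Prog.eval, hQ, hP], ?_⟩
  have := (((PolyBdd.const 1).add (PolyBdd.sum Finset.univ ht))).add (hs.comp hgb)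
  simpa only [Prog.steps, hQ] using this

theorem PolyTime.input (i : Fin n) : PolyTime (fun (_ : FieldEnum.{u}) (x : Fin n → ℕ) => x i) :=
  ⟨.input i, fun _ _ => rfl, PolyBdd.const 1⟩

theorem PolyTime.succ {f : FieldEnum.{u} → (Fin n → ℕ) → ℕ} (hf : PolyTime f) :
    PolyTime (fun Γ x => f Γ x + 1) :=
  PolyTime.comp (m := 1) (f := fun _ x => x 0 + 1) (g := fun _ => f)
    ⟨.succ, fun _ _ => rfl, PolyBdd.const 1⟩ fun _ => hf

theorem PolyTime.const (c : ℕ) : PolyTime (fun (_ : FieldEnum.{u}) (_ : Fin n → ℕ) => c) := by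
  induction c with
  | zero => exact ⟨.zero, fun _ _ => rfl, PolyBdd.const 1⟩
  | succ c ih => exact ih.succ

/-- Definition by primitive recursion with polynomially bounded values. -/
theorem PolyTime.natRec {c b : FieldEnum.{u} → (Fin n → ℕ) → ℕ}
    {g : FieldEnum.{u} → ℕ → ℕ → (Fin n → ℕ) → ℕ} (hc : PolyTime c) (hb : PolyTime b)
    (hg : PolyTime (n := n + 2) fun Γ z => g Γ (z 0) (z 1) fun j => z j.succ.succ)
    (hbd : PolyBdd (n := n + 1) fun Γ z =>
      Nat.rec (b Γ (Fin.tail z)) (fun i y => g Γ i y (Fin.tail z)) (z 0)) :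
    PolyTime (fun Γ x => Nat.rec (b Γ x) (fun i y => g Γ i y x) (c Γ x)) := by
  have key : PolyTime (n := n + 1) fun Γ z =>
      Nat.rec (b Γ (Fin.tail z)) (fun i y => g Γ i y (Fin.tail z)) (z 0) := by
    obtain ⟨P, hP, hPs⟩ := hb
    obtain ⟨Q, hQ, K, hK⟩ := hg
    have hev : ∀ (Γ : FieldEnum.{u}) (z : Fin (n + 1) → ℕ), (Prog.loop P Q).eval Γ.enum z =
        Nat.rec (b Γ (Fin.tail z)) (fun i y => g Γ i y (Fin.tail z)) (z 0) := by
      intro Γ z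
      simp only [Prog.eval, hP, hQ]
      rfl
    refine ⟨.loop P Q, hev, ?_⟩
    obtain ⟨L, hL⟩ := hbd
    have h1 : PolyBdd (n := n + 1) fun Γ z => P.steps Γ.enum (Fin.tail z) :=
      PolyBdd.comp (g := fun (j : Fin n) _ (z : Fin (n + 1) → ℕ) => z j.succ) hPs
        fun j => PolyBdd.input _
    have h2 : PolyBdd (n := n + 1) fun Γ z =>
        z 0 * (1 + (LRC.size Γ z + LRC.size Γ z ^ L) ^ K) :=
      (PolyBdd.input 0).mul ((PolyBdd.const 1).add ((PolyBdd.size.add (PolyBdd.size.pow L)).pow K))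
    refine (((PolyBdd.const 1).add h1).add h2).mono fun Γ z => ?_
    simp only [Prog.steps]
    refine Nat.add_le_add_left ?_ _
    calc _ ≤ ∑ i ∈ Finset.range (z 0), (1 + (LRC.size Γ z + LRC.size Γ z ^ L) ^ K) := by
          refine Finset.sum_le_sum fun i hi => Nat.add_le_add_left ?_ _
          refine (hK Γ _).trans (Nat.pow_le_pow_left ?_ K)
          have hi : i < z 0 := Finset.mem_range.1 hi
          -- The values inside the loop are those of the same recursion stopped earlier, so `hbd`
          -- bounds them all by one power of the size.
          have hsz : LRC.size Γ (Fin.cons i (Fin.tail z) : Fin (n + 1) → ℕ) ≤ LRC.size Γ z := by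
            simp only [LRC.size, Fin.sum_univ_succ, Fin.cons_zero, Fin.cons_succ, Fin.tail]
            omega
          have hv := (hL Γ (Fin.cons i (Fin.tail z))).trans (Nat.pow_le_pow_left hsz L)
          beta_reduce at hv
          rw [← hev] at hv
          simp only [LRC.size, Fin.sum_univ_succ, Fin.cons_zero, Fin.cons_succ, Fin.tail] at hv ⊢
          omega
      _ = _ := by simp
  exact PolyTime.comp (g := fun j Γ x => (Fin.cons (c Γ x) x : Fin (n + 1) → ℕ) j) key
    (fun j => Fin.cases (by simpa using hc) (fun i => by simpa using PolyTime.input i) j)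

theorem PolyTime.add {f g : FieldEnum.{u} → (Fin n → ℕ) → ℕ} (hf : PolyTime f) (hg : PolyTime g) :
    PolyTime (fun Γ x => f Γ x + g Γ x) := by
  have hrec : ∀ a b : ℕ, (Nat.rec a (fun _ y => y + 1) b : ℕ) = a + b := by
    intro a b; induction b with
    | zero => rfl
    | succ b ih => exact congrArg (· + 1) ih
  refine (PolyTime.natRec (g := fun _ _ y _ => y + 1) hg hf (PolyTime.input 1).succ ?_).of_eq
    fun Γ x => hrec _ _
  simp only [hrec]
  exact (PolyBdd.comp (g := fun (j : Fin n) _ (z : Fin (n + 1) → ℕ) => z j.succ) hf.polyBdd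
        fun j => PolyBdd.input _).add (PolyBdd.input 0)

/-- Lifting a function to a context with one more variable. -/
theorem PolyTime.tail {f : FieldEnum.{u} → (Fin n → ℕ) → ℕ} (hf : PolyTime f) :
    PolyTime (n := n + 1) (fun Γ z => f Γ fun j => z j.succ) :=
  PolyTime.comp (g := fun (j : Fin n) _ (z : Fin (n + 1) → ℕ) => z j.succ) hf
    fun _ => PolyTime.input _

theorem PolyTime.sum_range {c : FieldEnum.{u} → (Fin n → ℕ) → ℕ}
    {g : FieldEnum.{u} → ℕ → (Fin n → ℕ) → ℕ} (hc : PolyTime c)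
    (hg : PolyTime (n := n + 1) fun Γ z => g Γ (z 0) fun j => z j.succ) :
    PolyTime (fun Γ x => ∑ i ∈ Finset.range (c Γ x), g Γ i x) := by
  have hrec : ∀ (f : ℕ → ℕ) (b : ℕ), (Nat.rec 0 (fun i y => y + f i) b : ℕ) =
      ∑ i ∈ Finset.range b, f i := by
    intro f b; induction b with
    | zero => rfl
    | succ b ih => rw [Finset.sum_range_succ, ← ih]
  have hg' : PolyTime (n := n + 2) fun Γ z => g Γ (z 0) fun j => z j.succ.succ :=
    PolyTime.comp (g := fun (j : Fin (n + 1)) _ (z : Fin (n + 2) → ℕ) =>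
      (Fin.cons (z 0) (fun j => z j.succ.succ) : Fin (n + 1) → ℕ) j) hg
      fun j => Fin.cases (PolyTime.input _) (fun i => PolyTime.input _) j
  refine (PolyTime.natRec (g := fun Γ i y x => y + g Γ i x) hc (PolyTime.const 0)
    ((PolyTime.input 1).add hg') ?_).of_eq fun Γ x => hrec _ _
  simp only [hrec]
  obtain ⟨K, hK⟩ := hg.polyBdd
  refine ((PolyBdd.input 0).mul (PolyBdd.size.pow K)).mono fun Γ z => ?_
  calc _ ≤ ∑ i ∈ Finset.range (z 0), LRC.size Γ z ^ K := by
        refine Finset.sum_le_sum fun i hi => ?_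
        have hi : i < z 0 := Finset.mem_range.1 hi
        refine (hK Γ (Fin.cons i (Fin.tail z))).trans (Nat.pow_le_pow_left ?_ K)
        simp only [LRC.size, Fin.sum_univ_succ, Fin.cons_zero, Fin.cons_succ, Fin.tail]
        omega
    _ = _ := by simp

theorem PolyTime.mul {f g : FieldEnum.{u} → (Fin n → ℕ) → ℕ} (hf : PolyTime f) (hg : PolyTime g) :
    PolyTime (fun Γ x => f Γ x * g Γ x) :=
  (PolyTime.sum_range (g := fun Γ _ x => g Γ x) hf hg.tail).of_eq fun _ _ => by simp

theorem PolyTime.pred {f : FieldEnum.{u} → (Fin n → ℕ) → ℕ} (hf : PolyTime f) :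
    PolyTime (fun Γ x => f Γ x - 1) := by
  have hrec : ∀ b : ℕ, (Nat.rec 0 (fun i _ => i) b : ℕ) = b - 1 := by
    intro b; cases b <;> rfl
  refine (PolyTime.natRec (g := fun _ i _ _ => i) hf (PolyTime.const 0)
    (PolyTime.input 0) ?_).of_eq fun Γ x => hrec _
  simp only [hrec]
  exact (PolyBdd.input 0).mono fun Γ x => Nat.sub_le _ _

theorem PolyTime.sub {f g : FieldEnum.{u} → (Fin n → ℕ) → ℕ} (hf : PolyTime f) (hg : PolyTime g) :
    PolyTime (fun Γ x => f Γ x - g Γ x) := by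
  have hrec : ∀ a b : ℕ, (Nat.rec a (fun _ y => y - 1) b : ℕ) = a - b := by
    intro a b; induction b with
    | zero => rfl
    | succ b ih => exact congrArg (· - 1) ih
  refine (PolyTime.natRec (g := fun _ _ y _ => y - 1) hg hf (PolyTime.input 1).pred ?_).of_eq
    fun Γ x => hrec _ _
  simp only [hrec]
  exact hf.tail.polyBdd.mono fun Γ x => Nat.sub_le _ _

/-- Branching is arithmetic: with truncated subtraction, 1 - c and 1 - (1 - c) are the indicators of
c = 0 and of c ≠ 0. -/
theorem PolyTime.ite_eq_zero {c f g : FieldEnum.{u} → (Fin n → ℕ) → ℕ} (hc : PolyTime c)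
    (hf : PolyTime f) (hg : PolyTime g) :
    PolyTime (fun Γ x => if c Γ x = 0 then f Γ x else g Γ x) :=
  ((((PolyTime.const 1).sub hc).mul hf).add
    (((PolyTime.const 1).sub ((PolyTime.const 1).sub hc)).mul hg)).of_eq fun Γ x => by
      split_ifs with h
      · simp [h]
      · have : 1 - c Γ x = 0 := by omega
        simp [this]

theorem PolyTime.ite_le {c d f g : FieldEnum.{u} → (Fin n → ℕ) → ℕ} (hc : PolyTime c)
    (hd : PolyTime d) (hf : PolyTime f) (hg : PolyTime g) :
    PolyTime (fun Γ x => if c Γ x ≤ d Γ x then f Γ x else g Γ x) :=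
  ((hc.sub hd).ite_eq_zero hf hg).of_eq fun Γ x => by simp only [Nat.sub_eq_zero_iff_le]

theorem PolyTime.ite_lt {c d f g : FieldEnum.{u} → (Fin n → ℕ) → ℕ} (hc : PolyTime c)
    (hd : PolyTime d) (hf : PolyTime f) (hg : PolyTime g) :
    PolyTime (fun Γ x => if c Γ x < d Γ x then f Γ x else g Γ x) :=
  hc.succ.ite_le hd hf hg

theorem PolyTime.ite_eq {c d f g : FieldEnum.{u} → (Fin n → ℕ) → ℕ} (hc : PolyTime c)
    (hd : PolyTime d) (hf : PolyTime f) (hg : PolyTime g) :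
    PolyTime (fun Γ x => if c Γ x = d Γ x then f Γ x else g Γ x) :=
  (((hc.sub hd).add (hd.sub hc)).ite_eq_zero hf hg).of_eq fun Γ x => by
    have : c Γ x - d Γ x + (d Γ x - c Γ x) = 0 ↔ c Γ x = d Γ x := by omega
    simp only [this]

theorem PolyTime.min {f g : FieldEnum.{u} → (Fin n → ℕ) → ℕ} (hf : PolyTime f) (hg : PolyTime g) :
    PolyTime (fun Γ x => Min.min (f Γ x) (g Γ x)) :=
  (hf.ite_le hg hf hg).of_eq fun _ _ => (min_def _ _).symm

/-- The quotient counts the positive multiples of the divisor up to the dividend. Division by zero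
is split off, since all multiples of 0 would be counted. -/
theorem PolyTime.div {f g : FieldEnum.{u} → (Fin n → ℕ) → ℕ} (hf : PolyTime f) (hg : PolyTime g) :
    PolyTime (fun Γ x => f Γ x / g Γ x) := by
  have hs : PolyTime fun Γ x => ∑ i ∈ Finset.range (f Γ x),
      if (i + 1) * g Γ x ≤ f Γ x then 1 else 0 :=
    PolyTime.sum_range (g := fun Γ i x => if (i + 1) * g Γ x ≤ f Γ x then 1 else 0) hf
      ((((PolyTime.input 0).succ).mul hg.tail).ite_le hf.tail (PolyTime.const 1) (PolyTime.const 0))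
  refine (hg.ite_eq_zero (PolyTime.const 0) hs).of_eq fun Γ x => ?_
  generalize f Γ x = a
  generalize g Γ x = b
  split_ifs with hb
  · simp [hb]
  · have hb : 0 < b := by omega
    rw [Finset.sum_boole, Nat.cast_id]
    have : Finset.filter (fun i => (i + 1) * b ≤ a) (Finset.range a) = Finset.range (a / b) := by
      ext i
      have := Nat.div_le_self a b
      simp only [Finset.mem_filter, Finset.mem_range, ← Nat.le_div_iff_mul_le hb]
      omega
    rw [this, Finset.card_range]

theorem PolyTime.mod {f g : FieldEnum.{u} → (Fin n → ℕ) → ℕ} (hf : PolyTime f) (hg : PolyTime g) :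
    PolyTime (fun Γ x => f Γ x % g Γ x) :=
  (hf.sub (hg.mul (hf.div hg))).of_eq fun Γ x => by
    have := Nat.div_add_mod (f Γ x) (g Γ x)
    omega

theorem PolyTime.pow_const {f : FieldEnum.{u} → (Fin n → ℕ) → ℕ} (hf : PolyTime f) (k : ℕ) :
    PolyTime (fun Γ x => f Γ x ^ k) := by
  induction k with
  | zero => simpa using PolyTime.const 1
  | succ k ih => simpa only [pow_succ] using ih.mul hf

theorem PolyTime.sum_const_range (k : ℕ) {f : ℕ → FieldEnum.{u} → (Fin n → ℕ) → ℕ}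
    (hf : ∀ j, PolyTime (f j)) : PolyTime (fun Γ x => ∑ j ∈ Finset.range k, f j Γ x) := by
  induction k with
  | zero => simpa using PolyTime.const 0
  | succ k ih => simpa only [Finset.sum_range_succ] using ih.add (hf k)

/-- Powers of two, cut off at a given bound. -/
theorem PolyTime.min_two_pow {e B : FieldEnum.{u} → (Fin n → ℕ) → ℕ} (he : PolyTime e)
    (hB : PolyTime B) : PolyTime (fun Γ x => Min.min (2 ^ e Γ x) (B Γ x)) := by
  -- The cut-off may be applied after every doubling without changing the result, which keeps all
  -- intermediate values bounded.
  have hrec : ∀ B e : ℕ,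
      (Nat.rec (Min.min 1 B) (fun _ y => Min.min (2 * y) B) e : ℕ) = Min.min (2 ^ e) B := by
    intro B e; induction e with
    | zero => simp
    | succ e ih =>
      change Min.min (2 * _) B = _
      rw [ih, pow_succ]
      omega
  refine (PolyTime.natRec (g := fun Γ _ y x => Min.min (2 * y) (B Γ x)) he
    ((PolyTime.const 1).min hB)
    (((PolyTime.const 2).mul (PolyTime.input 1)).min hB.tail.tail) ?_).of_eq fun Γ x => hrec _ _
  simp only [hrec]
  exact hB.tail.polyBdd.mono fun Γ x => min_le_right _ _

end PolyTime

/-! ### Field arithmetic in polynomial time. -/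

section FieldPolyTime

variable {n : ℕ}

/-- The field-valued function `f` is computed by a program in polynomial time. -/
def FieldPolyTime (f : (Γ : FieldEnum.{u}) → (Fin n → ℕ) → Γ.F) : Prop :=
  PolyTime fun Γ x => idx Γ.enum (f Γ x)

theorem FieldPolyTime.zero : FieldPolyTime (fun (Γ : FieldEnum.{u}) (_ : Fin n → ℕ) => (0 : Γ.F)) :=
  ⟨.fzero, fun _ _ => rfl, PolyBdd.const 1⟩

theorem FieldPolyTime.one : FieldPolyTime (fun (Γ : FieldEnum.{u}) (_ : Fin n → ℕ) => (1 : Γ.F)) :=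
  ⟨.fone, fun _ _ => rfl, PolyBdd.const 1⟩

theorem FieldPolyTime.mul {f g : (Γ : FieldEnum.{u}) → (Fin n → ℕ) → Γ.F} (hf : FieldPolyTime f)
    (hg : FieldPolyTime g) : FieldPolyTime (fun Γ x => f Γ x * g Γ x) :=
  (PolyTime.comp (m := 2) (f := fun Γ x => idx Γ.enum (elt Γ.enum (x 0) * elt Γ.enum (x 1)))
    (g := ![fun Γ x => idx Γ.enum (f Γ x), fun Γ x => idx Γ.enum (g Γ x)])
    ⟨.fmul, fun _ _ => rfl, PolyBdd.const 1⟩ (Fin.cases hf (Fin.cases hg (fun i => i.elim0)))).of_eq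
    fun Γ x => by simp

/-- Adding the zero of the field replaces any number, even one not below q, by the number of the
element it stands for. -/
theorem FieldPolyTime.elt {f : FieldEnum.{u} → (Fin n → ℕ) → ℕ} (hf : PolyTime f) :
    FieldPolyTime (fun Γ x => elt Γ.enum (f Γ x)) :=
  (PolyTime.comp (m := 2) (f := fun Γ x => idx Γ.enum (LRC.elt Γ.enum (x 0) + LRC.elt Γ.enum (x 1)))
    (g := ![f, fun Γ x => idx Γ.enum (0 : Γ.F)])
    ⟨.fadd, fun _ _ => rfl, PolyBdd.const 1⟩
    (Fin.cases hf (Fin.cases FieldPolyTime.zero (fun i => i.elim0)))).of_eq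
    fun Γ x => by simp

theorem FieldPolyTime.sub {f g : (Γ : FieldEnum.{u}) → (Fin n → ℕ) → Γ.F} (hf : FieldPolyTime f)
    (hg : FieldPolyTime g) : FieldPolyTime (fun Γ x => f Γ x - g Γ x) := by
  have hneg : FieldPolyTime (fun Γ x => - g Γ x) :=
    (PolyTime.comp (m := 1) (f := fun Γ x => idx Γ.enum (-LRC.elt Γ.enum (x 0)))
      (g := ![fun Γ x => idx Γ.enum (g Γ x)])
      ⟨.fneg, fun _ _ => rfl, PolyBdd.const 1⟩ (Fin.cases hg (fun i => i.elim0))).of_eq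
      fun Γ x => by simp
  exact (PolyTime.comp (m := 2)
    (f := fun Γ x => idx Γ.enum (LRC.elt Γ.enum (x 0) + LRC.elt Γ.enum (x 1)))
    (g := ![fun Γ x => idx Γ.enum (f Γ x), fun Γ x => idx Γ.enum (-g Γ x)])
    ⟨.fadd, fun _ _ => rfl, PolyBdd.const 1⟩
    (Fin.cases hf (Fin.cases hneg (fun i => i.elim0)))).of_eq
    fun Γ x => by simp [sub_eq_add_neg]

theorem FieldPolyTime.pow {f : (Γ : FieldEnum.{u}) → (Fin n → ℕ) → Γ.F}
    {e : FieldEnum.{u} → (Fin n → ℕ) → ℕ} (hf : FieldPolyTime f) (he : PolyTime e) :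
    FieldPolyTime (fun Γ x => f Γ x ^ e Γ x) := by
  have hrec : ∀ (Γ : FieldEnum.{u}) (a : Γ.F) (e : ℕ),
      (Nat.rec (idx Γ.enum 1) (fun _ y => idx Γ.enum (LRC.elt Γ.enum y * a)) e : ℕ) =
        idx Γ.enum (a ^ e) := by
    intro Γ a e; induction e with
    | zero => simp
    | succ e ih =>
      change idx Γ.enum (LRC.elt Γ.enum _ * a) = _
      rw [ih, pow_succ, elt_idx]
  refine (PolyTime.natRec (g := fun Γ _ y x => idx Γ.enum (LRC.elt Γ.enum y * f Γ x)) he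
    FieldPolyTime.one
    (FieldPolyTime.mul (FieldPolyTime.elt (PolyTime.input 1)) (PolyTime.tail (PolyTime.tail hf)))
      ?_).of_eq fun Γ x => hrec _ _ _
  simp only [hrec]
  exact PolyBdd.q.mono fun Γ x => (idx_lt _ _).le

theorem FieldPolyTime.ite_lt {c d : FieldEnum.{u} → (Fin n → ℕ) → ℕ}
    {f g : (Γ : FieldEnum.{u}) → (Fin n → ℕ) → Γ.F} (hc : PolyTime c)
    (hd : PolyTime d) (hf : FieldPolyTime f) (hg : FieldPolyTime g) :
    FieldPolyTime (fun Γ x => if c Γ x < d Γ x then f Γ x else g Γ x) :=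
  (PolyTime.ite_lt hc hd hf hg).of_eq fun Γ x => by beta_reduce; split_ifs <;> rfl

theorem FieldPolyTime.ite_eq {c d : FieldEnum.{u} → (Fin n → ℕ) → ℕ}
    {f g : (Γ : FieldEnum.{u}) → (Fin n → ℕ) → Γ.F} (hc : PolyTime c)
    (hd : PolyTime d) (hf : FieldPolyTime f) (hg : FieldPolyTime g) :
    FieldPolyTime (fun Γ x => if c Γ x = d Γ x then f Γ x else g Γ x) :=
  (PolyTime.ite_eq hc hd hf hg).of_eq fun Γ x => by beta_reduce; split_ifs <;> rfl

end FieldPolyTime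

/-! ### A Behrend-type set from a paraboloid. -/

section Digits

/-- Signed digits smaller than the base are determined by the number that they represent. -/
theorem eq_zero_of_sum_mul_pow_eq_zero {d : ℤ} (hd : 0 < d) (s : ℕ) (y : ℕ → ℤ) (Y : ℤ)
    (hy : ∀ i < s, |y i| < d)
    (h : ∑ i ∈ Finset.range s, y i * d ^ i + Y * d ^ s = 0) : (∀ i < s, y i = 0) ∧ Y = 0 := by
  induction s generalizing y with
  | zero => simpa using h
  | succ s ih =>
    rw [Finset.sum_range_succ'] at h
    have e : ∑ i ∈ Finset.range s, y (i + 1) * d ^ (i + 1) =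
        d * ∑ i ∈ Finset.range s, y (i + 1) * d ^ i := by
      rw [Finset.mul_sum]
      exact Finset.sum_congr rfl fun i _ => by ring
    rw [e] at h
    -- Modulo d only the lowest digit survives; a multiple of d smaller than d in absolute value is
    -- 0.
    have h0 : y 0 = 0 := by
      refine Int.eq_zero_of_abs_lt_dvd (m := d)
        ⟨-(∑ i ∈ Finset.range s, y (i + 1) * d ^ i + Y * d ^ s), ?_⟩ (hy 0 (by omega))
      linear_combination h
    have h1 : ∑ i ∈ Finset.range s, y (i + 1) * d ^ i + Y * d ^ s = 0 := by
      have : d * (∑ i ∈ Finset.range s, y (i + 1) * d ^ i + Y * d ^ s) = 0 := by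
        rw [h0] at h
        linear_combination h
      exact (mul_eq_zero.1 this).resolve_left hd.ne'
    obtain ⟨h2, h3⟩ := ih (fun i => y (i + 1)) (fun i hi => hy (i + 1) (by omega)) h1
    refine ⟨fun i hi => ?_, h3⟩
    cases i with
    | zero => exact h0
    | succ i => exact h2 i (by omega)

/-- The number whose digits in base `d` are the coordinates of the point `(x, |x|²)` of a
paraboloid. -/
def paraboloid {R : Type*} [CommSemiring R] (d : R) (s : ℕ) (x : ℕ → R) : R :=
  ∑ i ∈ Finset.range s, x i * d ^ i + (∑ i ∈ Finset.range s, x i ^ 2) * d ^ s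

/-- The paraboloid contains no nontrivial solutions of a linear relation with three terms and
small coefficients. -/
theorem eq_of_paraboloid_relation {d d₀ B c₁ c₃ : ℤ} {s : ℕ} {x₁ x₂ x₃ : ℕ → ℤ} (hd : 0 < d)
    (hdB : 2 * B * d₀ ≤ d)
    (h₁ : ∀ i < s, 0 ≤ x₁ i ∧ x₁ i < d₀) (h₂ : ∀ i < s, 0 ≤ x₂ i ∧ x₂ i < d₀)
    (h₃ : ∀ i < s, 0 ≤ x₃ i ∧ x₃ i < d₀)
    (hc₁ : |c₁| ≤ B) (hc₃ : |c₃| ≤ B) (hc₁0 : c₁ ≠ 0) (hc : c₁ + c₃ ≠ 0)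
    (h : c₁ * (paraboloid d s x₁ - paraboloid d s x₂) +
      c₃ * (paraboloid d s x₃ - paraboloid d s x₂) = 0) :
    ∀ i < s, x₁ i = x₂ i := by
  have hB : 0 < B := (abs_pos.2 hc₁0).trans_le hc₁
  -- Each coordinate of the relation is at most 2B(d₀ - 1) < d in absolute value, so there are no
  -- carries: the relation holds for every coordinate and for the squared norms separately.
  obtain ⟨hy, hY⟩ := eq_zero_of_sum_mul_pow_eq_zero hd s
    (fun i => c₁ * (x₁ i - x₂ i) + c₃ * (x₃ i - x₂ i))
    (∑ i ∈ Finset.range s, (c₁ * (x₁ i ^ 2 - x₂ i ^ 2) + c₃ * (x₃ i ^ 2 - x₂ i ^ 2))) (by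
      intro i hi
      have a1 : |x₁ i - x₂ i| ≤ d₀ - 1 := by
        rw [abs_le]; have := h₁ i hi; have := h₂ i hi; constructor <;> linarith
      have a3 : |x₃ i - x₂ i| ≤ d₀ - 1 := by
        rw [abs_le]; have := h₃ i hi; have := h₂ i hi; constructor <;> linarith
      calc _ ≤ |c₁ * (x₁ i - x₂ i)| + |c₃ * (x₃ i - x₂ i)| := abs_add_le _ _
        _ ≤ B * (d₀ - 1) + B * (d₀ - 1) := by
          rw [abs_mul, abs_mul]; gcongr
        _ < d := by nlinarith) (by
      rw [← h]
      simp only [paraboloid, mul_sub, mul_add, add_mul, sub_mul, Finset.sum_add_distrib,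
        Finset.sum_sub_distrib, Finset.mul_sum, Finset.sum_mul, mul_assoc]
      ring)
  -- With a = x₁ - x₂ and b = x₃ - x₂, the coordinates give c₁a + c₃b = 0, and then the norms give ∑
  -- (c₁a² + c₃b²) = 0. Multiply by c₃ and substitute c₃b = -c₁a.
  have key : c₁ * (c₁ + c₃) * ∑ i ∈ Finset.range s, (x₁ i - x₂ i) ^ 2 = 0 := by
    rw [Finset.mul_sum, ← mul_zero c₃, ← hY, Finset.mul_sum]
    refine Finset.sum_congr rfl fun i hi => ?_
    have := hy i (Finset.mem_range.1 hi)
    linear_combination (c₁ * (x₁ i - x₂ i) - c₃ * (x₃ i - x₂ i) - 2 * c₃ * x₂ i) * this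
  have h0 := (mul_eq_zero.1 key).resolve_left (mul_ne_zero hc₁0 hc)
  rw [Finset.sum_eq_zero_iff_of_nonneg fun i _ => sq_nonneg _] at h0
  intro i hi
  have := h0 i (Finset.mem_range.2 hi)
  exact sub_eq_zero.1 (pow_eq_zero_iff (two_ne_zero)|>.1 this)

end Digits

/-! ### Agreement sets of two or three polynomials. -/

section Agreement

open Polynomial

variable {ι : Type*} (p : ι → ℤ[X]) (R m : ℕ)

/-- The points below `R` at which two polynomials of a family agree. -/
def agree (e e' : ι) : Finset ℕ :=
  (Finset.range R).filter fun i => (p e).eval (i : ℤ) = (p e').eval (i : ℤ)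

theorem agree_comm (e e' : ι) : agree p R e e' = agree p R e' e := by
  unfold agree
  exact Finset.filter_congr fun i _ => eq_comm

variable {p R m}

theorem card_agree_le (hp : ∀ e, (p e).natDegree ≤ m) {e e' : ι} (hne : p e ≠ p e') :
    (agree p R e e').card ≤ m := by
  by_contra hlt
  apply hne
  rw [← sub_eq_zero]
  refine eq_zero_of_natDegree_lt_card_of_eval_eq_zero' (p e - p e')
    ((agree p R e e').image (Nat.cast : ℕ → ℤ)) ?_ ?_
  · intro i hi
    obtain ⟨j, hj, rfl⟩ := Finset.mem_image.1 hi
    rw [eval_sub, sub_eq_zero]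
    exact (Finset.mem_filter.1 hj).2
  · rw [Finset.card_image_of_injective _ Nat.cast_injective]
    have := natDegree_sub_le_of_le (hp e) (hp e')
    simp only [max_self] at this
    omega

/-- The difference minus the right multiple of the node polynomial has degree below m and still
vanishes at the m nodes. -/
theorem sub_eq_of_card_agree (hp : ∀ e, (p e).natDegree ≤ m) {e e' : ι}
    (hcard : (agree p R e e').card = m) :
    p e - p e' = C ((p e).coeff m - (p e').coeff m) *
      ∏ j ∈ agree p R e e', (X - C (j : ℤ)) := by
  set Q : ℤ[X] := ∏ j ∈ agree p R e e', (X - C (j : ℤ)) with hQ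
  have hmon : Q.Monic := monic_prod_of_monic _ _ fun j _ => monic_X_sub_C _
  have hdeg : Q.natDegree = m := by
    rw [hQ, natDegree_prod_of_monic _ _ fun j _ => monic_X_sub_C _]
    simp only [natDegree_X_sub_C, Finset.sum_const, hcard, smul_eq_mul, mul_one]
  have hsub : (p e - p e').natDegree ≤ m := by
    simpa using natDegree_sub_le_of_le (hp e) (hp e')
  set D := p e - p e' - C ((p e).coeff m - (p e').coeff m) * Q with hD
  have hDm : D.natDegree ≤ m := by
    refine (natDegree_sub_le _ _).trans (max_le hsub ?_)
    exact (natDegree_C_mul_le _ _).trans hdeg.le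
  have hDc : D.coeff m = 0 := by
    have : Q.coeff m = 1 := by rw [← hdeg]; exact hmon
    rw [hD, coeff_sub, coeff_sub, coeff_C_mul, this, mul_one, sub_self]
  have hev : ∀ j ∈ agree p R e e', D.eval (j : ℤ) = 0 := by
    intro j hj
    have h1 : Q.eval (j : ℤ) = 0 := by
      rw [hQ, eval_prod]
      exact Finset.prod_eq_zero hj (by simp)
    have h2 := (Finset.mem_filter.1 hj).2
    simp [hD, h1, h2]
  rw [← sub_eq_zero, ← hD]
  by_contra hne
  refine hne (eq_zero_of_natDegree_lt_card_of_eval_eq_zero' D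
    ((agree p R e e').image (Nat.cast : ℕ → ℤ)) ?_ ?_)
  · intro i hi
    obtain ⟨j, hj, rfl⟩ := Finset.mem_image.1 hi
    exact hev j hj
  · rw [Finset.card_image_of_injective _ Nat.cast_injective, hcard]
    refine lt_of_le_of_ne hDm fun h => hne ?_
    rw [← leadingCoeff_eq_zero, leadingCoeff, h, hDc]

theorem abs_prod_sub_le {A : Finset ℕ} (hA : A ⊆ Finset.range R) {i : ℕ} (hi : i < R) :
    |∏ j ∈ A, ((i : ℤ) - j)| ≤ (R : ℤ) ^ A.card := by
  rw [Finset.abs_prod, ← Finset.prod_const]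
  refine Finset.prod_le_prod (fun j _ => abs_nonneg _) fun j hj => ?_
  have := Finset.mem_range.1 (hA hj)
  rw [abs_le]
  constructor <;> omega

/-- Three polynomials whose leading coefficients satisfy no short linear relation cannot agree
pairwise on disjoint sets of the largest possible size. -/
theorem false_of_disjoint_agree (hp : ∀ e, (p e).natDegree ≤ m) (hm : 1 ≤ m)
    (hrel : ∀ e₁ e₂ e₃ : ι, ∀ c₁ c₃ : ℤ, |c₁| ≤ (R : ℤ) ^ m → |c₃| ≤ (R : ℤ) ^ m → c₁ ≠ 0 →
      c₁ + c₃ ≠ 0 → c₁ * ((p e₁).coeff m - (p e₂).coeff m) +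
        c₃ * ((p e₃).coeff m - (p e₂).coeff m) = 0 → (p e₁).coeff m = (p e₂).coeff m)
    {e₁ e₂ e₃ : ι} (h₁₂ : p e₁ ≠ p e₂) (h₁₃ : p e₁ ≠ p e₃)
    (c₁₂ : (agree p R e₁ e₂).card = m) (c₁₃ : (agree p R e₁ e₃).card = m)
    (c₂₃ : (agree p R e₂ e₃).card = m)
    (hdisj : Disjoint (agree p R e₁ e₂) (agree p R e₁ e₃)) : False := by
  obtain ⟨i, hi⟩ : (agree p R e₁ e₃).Nonempty := Finset.card_pos.1 (by omega)
  have s₁₂ := sub_eq_of_card_agree hp c₁₂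
  have s₁₃ := sub_eq_of_card_agree hp c₁₃
  have s₂₃ := sub_eq_of_card_agree hp c₂₃
  have hiR : i < R := Finset.mem_range.1 (Finset.mem_filter.1 hi).1
  have hne : ∏ j ∈ agree p R e₁ e₂, ((i : ℤ) - j) ≠ 0 := by
    refine Finset.prod_ne_zero_iff.2 fun j hj h => ?_
    have : i = j := by omega
    exact Finset.disjoint_left.1 hdisj hj (this ▸ hi)
  -- At a point where the first and the third polynomial agree, these two factorizations combine to
  -- a linear relation between the leading coefficients. Its coefficients are the node products.
  have e₁₂ := congrArg (eval (i : ℤ)) s₁₂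
  have e₂₃ := congrArg (eval (i : ℤ)) s₂₃
  simp only [eval_sub, eval_mul, eval_C, eval_prod, eval_X] at e₁₂ e₂₃
  have hi' := (Finset.mem_filter.1 hi).2
  set c₁ := ∏ j ∈ agree p R e₁ e₂, ((i : ℤ) - j)
  set c₃ := ∏ j ∈ agree p R e₂ e₃, ((i : ℤ) - j)
  have hc₁ : |c₁| ≤ (R : ℤ) ^ m := c₁₂ ▸ abs_prod_sub_le (Finset.filter_subset _ _) hiR
  have hc₃ : |c₃| ≤ (R : ℤ) ^ m := c₂₃ ▸ abs_prod_sub_le (Finset.filter_subset _ _) hiR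
  have hsum : c₁ * ((p e₁).coeff m - (p e₂).coeff m) +
      -c₃ * ((p e₃).coeff m - (p e₂).coeff m) = 0 := by
    linear_combination -e₁₂ - e₂₃ + hi'
  -- The degenerate case, not covered by `hrel`: the relation then reduces to equality of the first
  -- and the third leading coefficient.
  by_cases hc : c₁ + -c₃ = 0
  · have h0 : c₁ * ((p e₁).coeff m - (p e₃).coeff m) = 0 := by
      linear_combination hsum - ((p e₃).coeff m - (p e₂).coeff m) * hc
    have := (mul_eq_zero.1 h0).resolve_left hne
    rw [this] at s₁₃
    exact h₁₃ (sub_eq_zero.1 (by simpa using s₁₃))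
  · have := hrel e₁ e₂ e₃ c₁ (-c₃) hc₁ (by rwa [abs_neg]) hne hc hsum
    rw [this] at s₁₂
    exact h₁₂ (sub_eq_zero.1 (by simpa using s₁₂))

/-- At most three blocks of a family of polynomial graphs do not contain subsets of size at least
`δ` that cover each of their points at least twice. -/
theorem false_of_double_cover {δ : ℕ} (hδ : 2 ≤ δ) (hp : ∀ e, (p e).natDegree ≤ δ / 2)
    (hinj : Function.Injective p)
    (hrel : ∀ e₁ e₂ e₃ : ι, ∀ c₁ c₃ : ℤ, |c₁| ≤ (R : ℤ) ^ (δ / 2) → |c₃| ≤ (R : ℤ) ^ (δ / 2) →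
      c₁ ≠ 0 → c₁ + c₃ ≠ 0 → c₁ * ((p e₁).coeff (δ / 2) - (p e₂).coeff (δ / 2)) +
        c₃ * ((p e₃).coeff (δ / 2) - (p e₂).coeff (δ / 2)) = 0 →
      (p e₁).coeff (δ / 2) = (p e₂).coeff (δ / 2))
    {E : Finset ι} (hE : E.Nonempty) (hE3 : E.card ≤ 3) (T : ι → Finset ℕ)
    (hT : ∀ e ∈ E, δ ≤ (T e).card)
    (hcov : ∀ e ∈ E, ∀ i ∈ T e, ∃ e' ∈ E, e' ≠ e ∧ i ∈ agree p R e e') : False := by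
  classical
  have hpos := hE.card_pos
  have hle : ∀ {e e'}, e ≠ e' → (agree p R e e').card ≤ δ / 2 :=
    fun h => card_agree_le hp (hinj.ne h)
  obtain h | h | h : E.card = 1 ∨ E.card = 2 ∨ E.card = 3 := by omega
  · obtain ⟨a, rfl⟩ := Finset.card_eq_one.1 h
    have := hT a (by simp)
    obtain ⟨i, hi⟩ : (T a).Nonempty := Finset.card_pos.1 (by omega)
    obtain ⟨e', he', hne, -⟩ := hcov a (by simp) i hi
    exact hne (by simpa using he')
  · obtain ⟨a, b, hab, rfl⟩ := Finset.card_eq_two.1 h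
    have h1 := hT a (by simp)
    have h2 : T a ⊆ agree p R a b := by
      intro i hi
      obtain ⟨e', he', hne, hi'⟩ := hcov a (by simp) i hi
      simp only [Finset.mem_insert, Finset.mem_singleton] at he'
      obtain rfl := he'.resolve_left hne
      exact hi'
    have := Finset.card_le_card h2
    have := hle hab
    omega
  · obtain ⟨a, b, c, hab, hac, hbc, rfl⟩ := Finset.card_eq_three.1 h
    have key : ∀ {a b c : ι}, a ≠ b → a ≠ c → δ ≤ (T a).card →
        (∀ i ∈ T a, ∃ e' ∈ ({a, b, c} : Finset ι), e' ≠ a ∧ i ∈ agree p R a e') →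
        (agree p R a b).card = δ / 2 ∧ (agree p R a c).card = δ / 2 ∧
          Disjoint (agree p R a b) (agree p R a c) := by
      intro a b c hab hac h1 hcov
      -- Two agreement sets of size at most ⌊δ/2⌋ cover at least δ points. For odd δ this is absurd;
      -- for even δ both have the full size and are disjoint.
      have h2 : T a ⊆ agree p R a b ∪ agree p R a c := by
        intro i hi
        obtain ⟨e', he', hne, hi'⟩ := hcov i hi
        simp only [Finset.mem_insert, Finset.mem_singleton] at he'
        obtain rfl | rfl := he'.resolve_left hne
        · exact Finset.mem_union_left _ hi'
        · exact Finset.mem_union_right _ hi'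
      have h3 := Finset.card_le_card h2
      have h4 := Finset.card_union_add_card_inter (agree p R a b) (agree p R a c)
      have := hle hab
      have := hle hac
      refine ⟨by omega, by omega, ?_⟩
      rw [Finset.disjoint_iff_inter_eq_empty, ← Finset.card_eq_zero]
      omega
    obtain ⟨k1, k2, k3⟩ := key hab hac (hT a (by simp)) (hcov a (by simp))
    obtain ⟨-, k4, -⟩ := key (c := b) hac.symm hbc.symm (hT c (by simp)) (by
      intro i hi
      obtain ⟨e', he', h⟩ := hcov c (by simp) i hi
      refine ⟨e', ?_, h⟩
      simp only [Finset.mem_insert, Finset.mem_singleton] at he' ⊢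
      tauto)
    rw [agree_comm p R c b] at k4
    exact false_of_disjoint_agree hp (by omega) hrel (hinj.ne hab) (hinj.ne hac) k1 k2 k4 k3

end Agreement

/-! ### Numbering the polynomials by digits. -/

section Blocks

/-- The digit with index `i` of the number `e` in base `B`. -/
def digit (B e i : ℕ) : ℕ := e / B ^ i % B

theorem digit_lt {B : ℕ} (hB : 0 < B) (e i : ℕ) : digit B e i < B := Nat.mod_lt _ hB

theorem eq_of_digit_eq {B : ℕ} {s : ℕ} {e e' : ℕ} (hd : ∀ i < s, digit B e i = digit B e' i)
    (h : e / B ^ s = e' / B ^ s) : e = e' := by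
  induction s with
  | zero => simpa using h
  | succ s ih =>
    refine ih (fun i hi => hd i (by omega)) ?_
    have h1 := hd s (by omega)
    rw [pow_succ, ← Nat.div_div_eq_div_mul, ← Nat.div_div_eq_div_mul] at h
    unfold digit at h1
    rw [← Nat.div_add_mod (e / B ^ s) B, ← Nat.div_add_mod (e' / B ^ s) B, h, h1]

/-- The leading coefficient of the polynomial with number `e`. -/
def blockLead (M m d d₀ s e : ℕ) : ℕ := paraboloid d s (digit d₀ (e / M ^ m))

/-- The value at `i` of the polynomial with number `e`: its lower coefficients are the first `m`
digits of `e` in base `M`, and the leading one is a point of the paraboloid. -/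
def blockVal (M m d d₀ s e i : ℕ) : ℕ :=
  ∑ j ∈ Finset.range m, digit M e j * i ^ j + blockLead M m d d₀ s e * i ^ m

open Polynomial in
/-- The polynomial with number `e`. -/
noncomputable def blockPoly (M m d d₀ s e : ℕ) : ℤ[X] :=
  ∑ j ∈ Finset.range m, C (digit M e j : ℤ) * X ^ j + C (blockLead M m d d₀ s e : ℤ) * X ^ m

variable {M m d d₀ s e e' : ℕ}

theorem blockPoly_eval (i : ℕ) :
    (blockPoly M m d d₀ s e).eval (i : ℤ) = (blockVal M m d d₀ s e i : ℤ) := by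
  simp [blockPoly, blockVal, Polynomial.eval_finsetSum]

theorem blockPoly_coeff_lt {j : ℕ} (hj : j < m) :
    (blockPoly M m d d₀ s e).coeff j = (digit M e j : ℤ) := by
  simp [blockPoly, Polynomial.coeff_X_pow, hj, hj.ne]

theorem blockPoly_coeff_self :
    (blockPoly M m d d₀ s e).coeff m = (blockLead M m d d₀ s e : ℤ) := by
  simp [blockPoly, Polynomial.coeff_X_pow]

theorem blockPoly_natDegree_le : (blockPoly M m d d₀ s e).natDegree ≤ m := by
  refine (Polynomial.natDegree_add_le _ _).trans (max_le ?_ (Polynomial.natDegree_C_mul_X_pow_le _ _))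
  refine Polynomial.natDegree_sum_le_of_forall_le _ _ fun j hj => ?_
  exact (Polynomial.natDegree_C_mul_X_pow_le _ _).trans (Finset.mem_range.1 hj).le

theorem natCast_paraboloid (x : ℕ → ℕ) :
    ((paraboloid d s x : ℕ) : ℤ) = paraboloid (d : ℤ) s fun i => (x i : ℤ) := by
  simp [paraboloid]

theorem blockLead_relation {B : ℕ} (hB : 0 < B) (hd₀ : 0 < d₀) (hd : 2 * B * d₀ ≤ d)
    {e₁ e₂ e₃ : ℕ} {c₁ c₃ : ℤ}
    (hc₁ : |c₁| ≤ B) (hc₃ : |c₃| ≤ B) (hc₁0 : c₁ ≠ 0) (hc : c₁ + c₃ ≠ 0)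
    (h : c₁ * ((blockLead M m d d₀ s e₁ : ℤ) - blockLead M m d d₀ s e₂) +
      c₃ * ((blockLead M m d d₀ s e₃ : ℤ) - blockLead M m d d₀ s e₂) = 0) :
    ∀ i < s, digit d₀ (e₁ / M ^ m) i = digit d₀ (e₂ / M ^ m) i := by
  simp only [blockLead, natCast_paraboloid] at h
  have hdig : ∀ (y i : ℕ), i < s → (0 : ℤ) ≤ (digit d₀ y i : ℤ) ∧ (digit d₀ y i : ℤ) < d₀ :=
    fun y i _ => ⟨by positivity, by exact_mod_cast digit_lt hd₀ y i⟩
  have hdpos : 0 < d := lt_of_lt_of_le (by positivity) hd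
  intro i hi
  exact_mod_cast eq_of_paraboloid_relation (d := d) (d₀ := d₀) (B := B) (by exact_mod_cast hdpos)
    (by exact_mod_cast hd) (hdig _) (hdig _) (hdig _) hc₁ hc₃ hc₁0 hc h i hi

theorem blockPoly_injOn (hd₀ : 0 < d₀) (hd : 2 * d₀ ≤ d) (he : e < M ^ m * d₀ ^ s)
    (he' : e' < M ^ m * d₀ ^ s) (h : blockPoly M m d d₀ s e = blockPoly M m d d₀ s e') :
    e = e' := by
  refine eq_of_digit_eq (B := M) (s := m) (fun j hj => ?_) ?_
  · have := congrArg (fun p => p.coeff j) h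
    simpa only [blockPoly_coeff_lt hj, Nat.cast_inj] using this
  · have h1 := congrArg (fun p => p.coeff m) h
    simp only [blockPoly_coeff_self] at h1
    -- The relation with the first number repeated and both coefficients 1 shows that equal leading
    -- coefficients have equal digits.
    refine eq_of_digit_eq (B := d₀) (s := s) (blockLead_relation (B := 1) (c₁ := 1) (c₃ := 1)
      (e₃ := e) one_pos hd₀ (by omega) (by simp) (by simp) (by simp) (by simp)
      (by rw [h1]; ring)) ?_
    rw [Nat.div_eq_of_lt (Nat.div_lt_of_lt_mul he), Nat.div_eq_of_lt (Nat.div_lt_of_lt_mul he')]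

theorem blockLead_lt (hd₀ : 0 < d₀) (hd : 2 * d₀ ≤ d) :
    blockLead M m d d₀ s e < d ^ s * (1 + s * d₀ ^ 2) := by
  have h1 : ∑ i ∈ Finset.range s, digit d₀ (e / M ^ m) i * d ^ i < d ^ s := by
    have hdig : ∀ i, digit d₀ (e / M ^ m) i + 1 ≤ d := fun i => by
      have := digit_lt hd₀ (e / M ^ m) i
      omega
    generalize s = t
    induction t with
    | zero => simp
    | succ t ih =>
      rw [Finset.sum_range_succ, pow_succ]
      calc _ < d ^ t + digit d₀ (e / M ^ m) t * d ^ t := by omega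
        _ = d ^ t * (digit d₀ (e / M ^ m) t + 1) := by ring
        _ ≤ _ := Nat.mul_le_mul_left _ (hdig t)
  have h2 : ∑ i ∈ Finset.range s, digit d₀ (e / M ^ m) i ^ 2 ≤ s * d₀ ^ 2 := by
    calc _ ≤ ∑ i ∈ Finset.range s, d₀ ^ 2 :=
          Finset.sum_le_sum fun i _ => Nat.pow_le_pow_left (digit_lt hd₀ _ _).le 2
      _ = _ := by simp
  unfold blockLead paraboloid
  calc _ < d ^ s + s * d₀ ^ 2 * d ^ s := add_lt_add_of_lt_of_le h1 (Nat.mul_le_mul_right _ h2)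
    _ = _ := by ring

theorem blockVal_lt {R i : ℕ} (hM : 0 < M) (hl : blockLead M m d d₀ s e < M) (hi : i < R) :
    blockVal M m d d₀ s e i < (m + 1) * R ^ m * M := by
  have hR : 0 < R := by omega
  have h1 : ∀ a j, a < M → j ≤ m → a * i ^ j ≤ (M - 1) * R ^ m := by
    intro a j ha hj
    exact Nat.mul_le_mul (by omega)
      ((Nat.pow_le_pow_left hi.le j).trans (Nat.pow_le_pow_right hR hj))
  unfold blockVal
  calc _ ≤ ∑ j ∈ Finset.range m, (M - 1) * R ^ m + (M - 1) * R ^ m :=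
        add_le_add (Finset.sum_le_sum fun j hj =>
          h1 _ _ (digit_lt hM _ _) (Finset.mem_range.1 hj).le) (h1 _ _ hl le_rfl)
    _ = (m + 1) * R ^ m * (M - 1) := by simp; ring
    _ < _ := Nat.mul_lt_mul_of_pos_left (by omega) (by positivity)

/-- At most three blocks given by the polynomials contain no subsets of size at least `δ` that
cover each of their points at least twice. -/
theorem false_of_blockVal_cover {δ R ℓ : ℕ} (hδ : 2 ≤ δ) (hR : 0 < R) (hd₀ : 0 < d₀)
    (hd : 2 * R ^ (δ / 2) * d₀ ≤ d) (hℓ : ℓ ≤ M ^ (δ / 2) * d₀ ^ s)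
    {E : Finset (Fin ℓ)} (hE : E.Nonempty) (hE3 : E.card ≤ 3) (T : Fin ℓ → Finset (Fin R))
    (hT : ∀ e ∈ E, δ ≤ (T e).card)
    (hcov : ∀ e ∈ E, ∀ i ∈ T e, ∃ e' ∈ E, e' ≠ e ∧
      blockVal M (δ / 2) d d₀ s e i = blockVal M (δ / 2) d d₀ s e' i) : False := by
  have hB : 0 < R ^ (δ / 2) := by positivity
  have hd2 : 2 * d₀ ≤ d := le_trans (by nlinarith) hd
  refine false_of_double_cover (p := fun e : Fin ℓ => blockPoly M (δ / 2) d d₀ s e) (R := R) hδ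
    (fun e => blockPoly_natDegree_le)
    (fun e e' h => Fin.ext (blockPoly_injOn hd₀ hd2 (by omega) (by omega) h)) ?_ hE hE3
    (fun e => (T e).map Fin.valEmbedding) (by simpa using hT) ?_
  · intro e₁ e₂ e₃ c₁ c₃ h1 h3 hc₁ hc h
    simp only [blockPoly_coeff_self] at h ⊢
    have := blockLead_relation (B := R ^ (δ / 2)) hB hd₀ hd (by exact_mod_cast h1)
      (by exact_mod_cast h3) hc₁ hc h
    unfold blockLead paraboloid
    congr 2
    · exact Finset.sum_congr rfl fun i hi => by rw [this i (Finset.mem_range.1 hi)]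
    · congr 1
      exact Finset.sum_congr rfl fun i hi => by rw [this i (Finset.mem_range.1 hi)]
  · intro e he i hi
    obtain ⟨i, hi', rfl⟩ := Finset.mem_map.1 hi
    obtain ⟨e', he', hne, h⟩ := hcov e he i hi'
    refine ⟨e', he', hne, Finset.mem_filter.2 ⟨by simp, ?_⟩⟩
    simpa only [blockPoly_eval, Nat.cast_inj, Fin.valEmbedding_apply] using h

end Blocks

/-! ### Independence of powers and Cauchy functions. -/

section Cauchy

open Polynomial

variable {F : Type*} [Field F] {κ : Type*}

/-- A vector orthogonal to the first `k` powers and to the functions `1 / (x - z)`, `z ∈ J`, is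
orthogonal to all quotients of polynomials of degree less than `k + |J|` by `∏ (x - z)`. -/
theorem sum_mul_eval_div_eq_zero {s : Finset κ} {X : κ → F} {u : κ → F} {k : ℕ}
    (hpow : ∀ t < k, ∑ x ∈ s, u x * X x ^ t = 0) (J : Finset F) (hJ : ∀ x ∈ s, X x ∉ J)
    (hinv : ∀ z ∈ J, ∑ x ∈ s, u x * (X x - z)⁻¹ = 0) (f : F[X])
    (hf : f.degree < (k + J.card : ℕ)) :
    ∑ x ∈ s, u x * (f.eval (X x) / ∏ z ∈ J, (X x - z)) = 0 := by
  classical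
  induction J using Finset.induction_on generalizing f with
  | empty =>
    simp only [Finset.prod_empty, div_one]
    simp only [Finset.card_empty, add_zero] at hf
    have he : ∀ x, f.eval x = ∑ t ∈ Finset.range k, f.coeff t * x ^ t := by
      intro x
      by_cases hf0 : f = 0
      · simp [hf0]
      · exact eval_eq_sum_range' ((natDegree_lt_iff_degree_lt hf0).2 hf) x
    simp only [he, Finset.mul_sum]
    rw [Finset.sum_comm]
    refine Finset.sum_eq_zero fun t ht => ?_
    calc _ = f.coeff t * ∑ x ∈ s, u x * X x ^ t := by
          rw [Finset.mul_sum]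
          exact Finset.sum_congr rfl fun x _ => by ring
      _ = 0 := by rw [hpow t (Finset.mem_range.1 ht), mul_zero]
  | insert z J hz ih =>
    have ih := ih (fun x hx h => hJ x hx (Finset.mem_insert_of_mem h))
      (fun y hy => hinv y (Finset.mem_insert_of_mem hy))
    have hzs := hinv z (Finset.mem_insert_self _ _)
    set P : F[X] := ∏ y ∈ J, (Polynomial.X - C y) with hP
    have hPev : ∀ x, P.eval x = ∏ y ∈ J, (x - y) := fun x => by simp [hP, eval_prod]
    have hPz : P.eval z ≠ 0 := by
      rw [hPev, Finset.prod_ne_zero_iff]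
      intro y hy h
      exact hz (by rwa [sub_eq_zero.1 h])
    have hPdeg : P.degree = J.card := by
      rw [hP, degree_prod]
      simp
    -- Partial fractions: this multiple of P makes the numerator divisible by X - z, which splits
    -- off a multiple of 1 / (x - z) and leaves one pole fewer.
    obtain ⟨g, hg⟩ : (Polynomial.X - C z) ∣ f - C (f.eval z / P.eval z) * P := by
      rw [dvd_iff_isRoot]
      simp [hPz]
    have hgdeg : g.degree < (k + J.card : ℕ) := by
      by_cases hg0 : g = 0
      · rw [hg0, degree_zero]
        exact WithBot.bot_lt_coe _
      have h1 : (f - C (f.eval z / P.eval z) * P).degree < (k + J.card + 1 : ℕ) := by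
        refine (degree_sub_le _ _).trans_lt (max_lt ?_ ?_)
        · rw [Finset.card_insert_of_notMem hz] at hf
          exact hf
        · rw [← smul_eq_C_mul]
          refine (degree_smul_le _ _).trans_lt ?_
          rw [hPdeg]
          exact_mod_cast (by omega)
      rw [hg, degree_mul, degree_X_sub_C, degree_eq_natDegree hg0] at h1
      rw [degree_eq_natDegree hg0]
      have h2 : 1 + g.natDegree < k + J.card + 1 := by exact_mod_cast h1
      exact_mod_cast (by omega)
    have hsplit : ∀ x ∈ s, u x * (f.eval (X x) / ∏ y ∈ insert z J, (X x - y)) =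
        (f.eval z / P.eval z) * (u x * (X x - z)⁻¹) +
          u x * (g.eval (X x) / ∏ y ∈ J, (X x - y)) := by
      intro x hx
      have hxz : X x - z ≠ 0 := fun h => hJ x hx (by rw [sub_eq_zero.1 h]; simp)
      have hxP : ∏ y ∈ J, (X x - y) ≠ 0 := by
        rw [Finset.prod_ne_zero_iff]
        exact fun y hy h => hJ x hx (by rw [sub_eq_zero.1 h]; simp [hy])
      have := congrArg (eval (X x)) hg
      simp only [eval_sub, eval_mul, eval_C, eval_X, hPev (X x)] at this
      rw [Finset.prod_insert hz, sub_eq_iff_eq_add.1 this]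
      field_simp
      ring
    rw [Finset.sum_congr rfl hsplit, Finset.sum_add_distrib, ← Finset.mul_sum, hzs, mul_zero,
      zero_add]
    exact ih g hgdeg

/-- The columns `(1, x, …, x ^ (k - 1), (1 / (x - z))_z)` for distinct `x` form a matrix of which
any set of columns as large as the number of rows is independent. -/
theorem add_card_lt_card_support {s : Finset κ} {X : κ → F} (hX : Set.InjOn X s) {u : κ → F} {k : ℕ}
    (hpow : ∀ t < k, ∑ x ∈ s, u x * X x ^ t = 0) (J : Finset F) (hJ : ∀ x ∈ s, X x ∉ J)
    (hinv : ∀ z ∈ J, ∑ x ∈ s, u x * (X x - z)⁻¹ = 0) (hs : s.Nonempty) (hu : ∀ x ∈ s, u x ≠ 0) :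
    k + J.card < s.card := by
  classical
  by_contra hlt
  obtain ⟨x₀, hx₀⟩ := hs
  have hcard := Finset.card_erase_add_one hx₀
  -- The numerator that vanishes at all points but that of x₀ has degree |s| - 1 < k + |J|.
  -- Orthogonality to it leaves a single term, which is nonzero.
  have h := sum_mul_eval_div_eq_zero hpow J hJ hinv
    (∏ y ∈ s.erase x₀, (Polynomial.X - C (X y))) (by
      rw [degree_prod]
      simp only [degree_X_sub_C, Finset.sum_const, nsmul_eq_mul, mul_one]
      exact_mod_cast (by omega))
  rw [Finset.sum_eq_single_of_mem x₀ hx₀] at h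
  · refine mul_ne_zero (hu x₀ hx₀) (div_ne_zero ?_ ?_) h
    · rw [eval_prod, Finset.prod_ne_zero_iff]
      intro y hy h
      simp only [eval_sub, eval_X, eval_C, sub_eq_zero] at h
      exact Finset.ne_of_mem_erase hy (hX (Finset.mem_of_mem_erase hy) hx₀ h.symm)
    · rw [Finset.prod_ne_zero_iff]
      exact fun y hy h => hJ x₀ hx₀ (by rw [sub_eq_zero.1 h]; exact hy)
  · intro y hy hne
    rw [eval_prod, Finset.prod_eq_zero (Finset.mem_erase.2 ⟨hne, hy⟩) (by simp)]
    simp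

theorem lt_card_support [Fintype κ] [DecidableEq F] {X : κ → F} (hX : Function.Injective X)
    {u : κ → F} {k : ℕ} (hpow : ∀ t < k, ∑ x, u x * X x ^ t = 0) (hu : u ≠ 0) :
    k < (Finset.univ.filter fun x => u x ≠ 0).card := by
  refine add_card_lt_card_support (s := Finset.univ.filter fun x => u x ≠ 0) (u := u)
    hX.injOn ?_ ∅ (by simp) (by simp) ?_ (by simp)
  · intro t ht
    refine (Finset.sum_subset (Finset.filter_subset _ _) fun x _ hx => ?_).trans (hpow t ht)
    have : u x = 0 := by
      by_contra h
      exact hx (Finset.mem_filter.2 ⟨Finset.mem_univ _, h⟩)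
    rw [this, zero_mul]
  · obtain ⟨x, hx⟩ := Function.ne_iff.1 hu
    exact ⟨x, by simpa using hx⟩

end Cauchy

/-! ### The code of a system of groups: distance, locality, dimension. -/

section Code

variable {F : Type*} [Field F]

/-- The data of a code with `ℓ` local groups of `R` symbols and `h` global parities: the points
attached to the symbols of the groups, the poles attached to the global parities, and the places of
all symbols. -/
structure GroupData (F : Type*) [Field F] (ℓ R h n : ℕ) where
  point : Fin ℓ → Fin R → F
  pole : Fin h → F
  place : Fin h ⊕ Fin ℓ × Fin R ≃ Fin n
  pole_injective : Function.Injective pole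
  point_ne_pole : ∀ e i j, point e i ≠ pole j
  eq_of_point_eq : ∀ {e e' i i'}, point e i = point e' i' → i = i'

namespace GroupData

variable {ℓ R h n : ℕ} (D : GroupData F ℓ R h n)

theorem point_injective (e : Fin ℓ) : Function.Injective (D.point e) :=
  fun _ _ h => D.eq_of_point_eq h

/-- The symbol of a word in a given local group at a given position. -/
def loc (c : Fin n → F) (e : Fin ℓ) (i : Fin R) : F := c (D.place (Sum.inr (e, i)))

/-- The global parity symbols of a word. -/
def glob (c : Fin n → F) (j : Fin h) : F := c (D.place (Sum.inl j))

/-- The parity checks of the code: `k` power sums vanish on each local group, and the global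
parities are given by a Cauchy matrix. -/
def IsWord (k : ℕ) (c : Fin n → F) : Prop :=
  (∀ e, ∀ t < k, ∑ i, D.loc c e i * D.point e i ^ t = 0) ∧
    ∀ j, D.glob c j + ∑ e, ∑ i, D.loc c e i * (D.point e i - D.pole j)⁻¹ = 0

theorem card_eq (D : GroupData F ℓ R h n) : n = h + ℓ * R := by
  simpa using (Fintype.card_congr D.place).symm

variable {D}

theorem eq_zero_of_loc_glob {c : Fin n → F} (h1 : ∀ e, D.loc c e = 0) (h2 : D.glob c = 0) :
    c = 0 := by
  funext a
  obtain ⟨b, rfl⟩ := D.place.surjective a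
  rcases b with j | ⟨e, i⟩
  · exact congrFun h2 j
  · exact congrFun (h1 e) i

theorem IsWord.eq_zero {k : ℕ} {c : Fin n → F} (hc : D.IsWord k c) (h1 : ∀ e, D.loc c e = 0) :
    c = 0 := by
  refine eq_zero_of_loc_glob h1 ?_
  funext j
  have := hc.2 j
  simpa [h1] using this

open Classical in
theorem hammingNorm_eq (c : Fin n → F) :
    hammingNorm c = (Finset.univ.filter fun j => D.glob c j ≠ 0).card +
      ∑ e, (Finset.univ.filter fun i => D.loc c e i ≠ 0).card := by
  unfold hammingNorm
  simp only [Finset.card_filter]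
  rw [← Equiv.sum_comp D.place, Fintype.sum_sum_type, Fintype.sum_prod_type]
  rfl

open Classical in
theorem IsWord.lt_card_loc {k : ℕ} {c : Fin n → F} (hc : D.IsWord k c) {e : Fin ℓ}
    (he : D.loc c e ≠ 0) : k < (Finset.univ.filter fun i => D.loc c e i ≠ 0).card :=
  lt_card_support (D.point_injective e) (hc.1 e) he

open Classical in
/-- The weight of a nonzero word is at least `h + δ`. -/
theorem IsWord.le_hammingNorm {δ : ℕ} (hδ : 1 ≤ δ) (hh : h ≤ 3 * δ)
    (hcover : ∀ E : Finset (Fin ℓ), E.Nonempty → E.card ≤ 3 → ∀ T : Fin ℓ → Finset (Fin R),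
      (∀ e ∈ E, δ ≤ (T e).card) →
      (∀ e ∈ E, ∀ i ∈ T e, ∃ e' ∈ E, e' ≠ e ∧ D.point e i = D.point e' i) → False)
    {c : Fin n → F} (hc : D.IsWord (δ - 1) c) (hc0 : c ≠ 0) : h + δ ≤ hammingNorm c := by
  rw [D.hammingNorm_eq]
  set X : Fin ℓ × Fin R → F := fun k => D.point k.1 k.2 with hX
  set v : Fin ℓ × Fin R → F := fun k => D.loc c k.1 k.2 with hv
  -- The global checks, and the local power checks summed over all groups, see the local symbols
  -- only through u.
  set u : F → F := fun x => ∑ k, if X k = x then v k else 0 with hu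
  have hsum : ∀ φ : F → F, ∑ x ∈ Finset.univ.image X, u x * φ x = ∑ k, v k * φ (X k) := by
    intro φ
    simp only [hu, Finset.sum_mul]
    rw [Finset.sum_comm]
    refine Finset.sum_congr rfl fun k _ => ?_
    rw [Finset.sum_eq_single_of_mem (X k) (Finset.mem_image_of_mem _ (Finset.mem_univ k))]
    · simp
    · intro y _ hy
      rw [if_neg hy.symm, zero_mul]
  set s := (Finset.univ.image X).filter fun x => u x ≠ 0 with hs
  have hsum' : ∀ φ : F → F, ∑ x ∈ s, u x * φ x = ∑ e, ∑ i, D.loc c e i * φ (D.point e i) := by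
    intro φ
    rw [← Fintype.sum_prod_type (f := fun k : Fin ℓ × Fin R => v k * φ (X k)), ← hsum]
    refine Finset.sum_subset (Finset.filter_subset _ _) fun x hx hx' => ?_
    have : u x = 0 := by
      by_contra hne
      exact hx' (Finset.mem_filter.2 ⟨hx, hne⟩)
    rw [this, zero_mul]
  have hwt : ∑ e, (Finset.univ.filter fun i => D.loc c e i ≠ 0).card =
      (Finset.univ.filter fun k => v k ≠ 0).card := by
    simp only [Finset.card_filter]
    rw [Fintype.sum_prod_type]
  by_cases hne : s.Nonempty
  -- A vanishing global symbol turns its check into orthogonality of u to 1 / (x - z). So u has at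
  -- least δ + |J| points in its support, while h - |J| global symbols are nonzero.
  · set J := (Finset.univ.filter fun j => ¬ D.glob c j ≠ 0).image D.pole with hJ
    have hJcard : (Finset.univ.filter fun j => D.glob c j ≠ 0).card + J.card = h := by
      rw [hJ, Finset.card_image_of_injective _ D.pole_injective,
        Finset.card_filter_add_card_filter_not]
      simp
    have h1 := add_card_lt_card_support (k := δ - 1) (s := s) (X := id) (u := u)
      (Function.injective_id.injOn) (by
        intro t ht
        rw [show ∑ x ∈ s, u x * id x ^ t = ∑ x ∈ s, u x * x ^ t from rfl, hsum' fun x => x ^ t]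
        exact Finset.sum_eq_zero fun e _ => hc.1 e t ht) J (by
        intro x hx hxJ
        obtain ⟨k, -, hk⟩ := Finset.mem_image.1 (Finset.mem_filter.1 hx).1
        obtain ⟨j, -, hj⟩ := Finset.mem_image.1 hxJ
        exact D.point_ne_pole k.1 k.2 j (hk.trans hj.symm)) (by
        intro z hz
        obtain ⟨j, hj, rfl⟩ := Finset.mem_image.1 hz
        have hj : D.glob c j = 0 := by simpa using hj
        have := hc.2 j
        rw [hj, zero_add] at this
        exact (hsum' fun x => (x - D.pole j)⁻¹).trans this) hne
        (fun x hx => (Finset.mem_filter.1 hx).2)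
    have h2 : s.card ≤ (Finset.univ.filter fun k => v k ≠ 0).card := by
      refine (Finset.card_le_card (t := (Finset.univ.filter fun k => v k ≠ 0).image X) ?_).trans
        Finset.card_image_le
      intro x hx
      obtain ⟨k, -, hk⟩ := Finset.exists_ne_zero_of_sum_ne_zero (Finset.mem_filter.1 hx).2
      have hkx : X k = x := by
        by_contra h
        exact hk (if_neg h)
      rw [if_pos hkx] at hk
      exact Finset.mem_image.2 ⟨k, by simpa using hk, hkx⟩
    rw [hwt]
    omega
  -- Now every nonzero local symbol is cancelled by others over the same point. These belong to
  -- other groups, as the points of one group are distinct.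
  · have hu0 : ∀ k, u (X k) = 0 := by
      intro k
      by_contra h
      exact hne ⟨X k, Finset.mem_filter.2 ⟨Finset.mem_image_of_mem _ (Finset.mem_univ k), h⟩⟩
    set E := Finset.univ.filter fun e => D.loc c e ≠ 0 with hE
    have hE0 : E.Nonempty := by
      by_contra h
      refine hc0 (hc.eq_zero fun e => ?_)
      by_contra he
      exact h ⟨e, Finset.mem_filter.2 ⟨Finset.mem_univ _, he⟩⟩
    have hT : ∀ e ∈ E, δ ≤ (Finset.univ.filter fun i => D.loc c e i ≠ 0).card := by
      intro e he
      have := hc.lt_card_loc (Finset.mem_filter.1 he).2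
      omega
    by_cases hE3 : E.card ≤ 3
    · refine (hcover E hE0 hE3 (fun e => Finset.univ.filter fun i => D.loc c e i ≠ 0) hT ?_).elim
      intro e he i hi
      have hi : v (e, i) ≠ 0 := by simpa using hi
      by_contra hno
      apply hi
      have := hu0 (e, i)
      rw [hu] at this
      dsimp only at this
      rw [Finset.sum_eq_single_of_mem (e, i) (Finset.mem_univ _), if_pos rfl] at this
      · exact this
      · rintro ⟨e', i'⟩ - hne'
        split_ifs with heq
        · obtain rfl : i' = i := D.eq_of_point_eq heq
          by_contra hv0
          refine hno ⟨e', Finset.mem_filter.2 ⟨Finset.mem_univ _, fun h0 => hv0 ?_⟩, ?_, heq.symm⟩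
          · exact congrFun h0 i'
          · rintro rfl
            exact hne' rfl
        · rfl
    · have h4 : E.card * δ ≤ ∑ e ∈ E, (Finset.univ.filter fun i => D.loc c e i ≠ 0).card := by
        rw [← smul_eq_mul]
        exact Finset.card_nsmul_le_sum _ _ _ hT
      have h5 : ∑ e ∈ E, (Finset.univ.filter fun i => D.loc c e i ≠ 0).card ≤
          ∑ e, (Finset.univ.filter fun i => D.loc c e i ≠ 0).card :=
        Finset.sum_le_sum_of_subset (Finset.subset_univ _)
      have h6 : 4 * δ ≤ E.card * δ := Nat.mul_le_mul_right _ (by omega)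
      omega

variable (D) in
open Classical in
/-- There is a nonzero word of weight at most `h + δ`. -/
theorem exists_isWord_hammingNorm_le {δ : ℕ} (hδ : 1 ≤ δ) (hℓ : 0 < ℓ) (hR : δ ≤ R) :
    ∃ c, D.IsWord (δ - 1) c ∧ c ≠ 0 ∧ hammingNorm c ≤ h + δ := by
  let e₀ : Fin ℓ := ⟨0, hℓ⟩
  let φ : (Fin δ → F) →ₗ[F] (Fin (δ - 1) → F) := Matrix.mulVecLin
    (Matrix.of fun t i => D.point e₀ (Fin.castLE hR i) ^ (t : ℕ))
  -- There are δ unknowns and δ - 1 equations, hence a nonzero local word on the first δ positions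
  -- of one group; the parities add weight at most h.
  have hker : LinearMap.ker φ ≠ ⊥ := LinearMap.ker_ne_bot_of_finrank_lt (by simp; omega)
  obtain ⟨a, ha, ha0⟩ := Submodule.exists_mem_ne_zero_of_ne_bot hker
  let v : Fin ℓ → Fin R → F := fun e i =>
    if e = e₀ then (if hi : (i : ℕ) < δ then a ⟨i, hi⟩ else 0) else 0
  let p : Fin h → F := fun j => -∑ e, ∑ i, v e i * (D.point e i - D.pole j)⁻¹
  let c : Fin n → F := fun b => Sum.elim p (fun k => v k.1 k.2) (D.place.symm b)
  have hloc : ∀ e i, D.loc c e i = v e i := by simp [loc, c]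
  have hglob : ∀ j, D.glob c j = p j := by simp [glob, c]
  have hv0 : ∀ i : Fin δ, v e₀ (Fin.castLE hR i) = a i := by simp [v]
  refine ⟨c, ⟨fun e t ht => ?_, fun j => ?_⟩, ?_, ?_⟩
  · simp only [hloc]
    by_cases he : e = e₀
    · subst he
      have h1 := congrFun (LinearMap.mem_ker.1 ha) ⟨t, ht⟩
      simp only [φ, Matrix.mulVecLin_apply, Matrix.mulVec, dotProduct, Matrix.of_apply,
        Pi.zero_apply] at h1
      rw [← h1]
      have h2 := Finset.sum_map Finset.univ (Fin.castLEEmb hR)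
        (fun i : Fin R => v e₀ i * D.point e₀ i ^ t)
      simp only [Fin.castLEEmb_apply, hv0] at h2
      rw [Finset.sum_congr rfl fun i _ => mul_comm (D.point e₀ (Fin.castLE hR i) ^ t) (a i), ← h2]
      refine (Finset.sum_subset (Finset.subset_univ _) fun i _ hi => ?_).symm
      have : ¬ (i : ℕ) < δ := fun h =>
        hi (Finset.mem_map.2 ⟨⟨i, h⟩, Finset.mem_univ _, Fin.ext rfl⟩)
      simp [v, this]
    · simp [v, he]
  · simp only [hloc, hglob, p]
    ring
  · obtain ⟨i, hi⟩ := Function.ne_iff.1 ha0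
    intro h0
    apply hi
    rw [← hv0 i, ← hloc, h0]
    rfl
  · rw [D.hammingNorm_eq]
    refine add_le_add ((Finset.card_le_univ _).trans (by simp)) ?_
    rw [Finset.sum_eq_single_of_mem e₀ (Finset.mem_univ _)]
    · refine (Finset.card_le_card (t := Finset.univ.map (Fin.castLEEmb hR)) ?_).trans (by simp)
      intro i hi
      have hi : v e₀ i ≠ 0 := by simpa [hloc] using hi
      have : (i : ℕ) < δ := by
        by_contra h
        exact hi (by simp [v, h])
      exact Finset.mem_map.2 ⟨⟨i, this⟩, Finset.mem_univ _, Fin.ext rfl⟩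
    · intro e _ he
      simp [hloc, v, he]

open Classical in
theorem hasLocality {C : Submodule F (Fin n → F)} {r δ : ℕ} (hδ : 1 ≤ δ) (hR : R ≤ r + δ - 1)
    (hC : ∀ c ∈ C, D.IsWord (δ - 1) c) (e : Fin ℓ) (i : Fin R) :
    HasLocality C r δ (D.place (Sum.inr (e, i))) := by
  let g : Fin R ↪ Fin n := ⟨fun i => D.place (Sum.inr (e, i)), fun i i' h => by
    simpa using h⟩
  refine ⟨Finset.univ.map g, Finset.mem_map_of_mem g (Finset.mem_univ i), by simpa using hR, ?_⟩
  intro w hw hw0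
  obtain ⟨c, hc, rfl⟩ := Submodule.mem_map.1 hw
  have hloc : D.loc c e ≠ 0 := by
    intro h0
    apply hw0
    funext a
    obtain ⟨a, ha⟩ := a
    obtain ⟨i, -, rfl⟩ := Finset.mem_map.1 ha
    exact congrFun h0 i
  have h1 := (hC c hc).lt_card_loc hloc
  have h2 : (Finset.univ.filter fun i => D.loc c e i ≠ 0).card ≤
      hammingNorm (LinearMap.funLeft F F (Subtype.val : Finset.univ.map g → Fin n) c) := by
    refine Finset.card_le_card_of_injOn
      (fun i => ⟨g i, Finset.mem_map_of_mem g (Finset.mem_univ i)⟩) ?_ ?_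
    · intro i hi
      have hi : D.loc c e i ≠ 0 := by simpa using hi
      exact Finset.mem_coe.2 (Finset.mem_filter.2 ⟨Finset.mem_univ _, hi⟩)
    · intro i _ i' _ h
      exact g.injective (congrArg Subtype.val h)
  convert (show δ ≤ _ by omega : δ ≤ hammingNorm
    (LinearMap.funLeft F F (Subtype.val : Finset.univ.map g → Fin n) c))

/-- The code of the group data is an optimal locally repairable code. -/
theorem isOptimalInfoLRC {r δ : ℕ} (hr : 1 ≤ r) (hδ : 1 ≤ δ) (hh : h ≤ 3 * δ) (hℓ : 0 < ℓ)
    (hR : R = r + δ - 1)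
    (hcover : ∀ E : Finset (Fin ℓ), E.Nonempty → E.card ≤ 3 → ∀ T : Fin ℓ → Finset (Fin R),
      (∀ e ∈ E, δ ≤ (T e).card) →
      (∀ e ∈ E, ∀ i ∈ T e, ∃ e' ∈ E, e' ≠ e ∧ D.point e i = D.point e' i) → False)
    {C : Submodule F (Fin n → F)} (hC : ∀ c, c ∈ C ↔ D.IsWord (δ - 1) c)
    (hdim : r * ℓ ≤ Module.finrank F C) : IsOptimalInfoLRC C (r * ℓ) (h + δ) r δ := by
  classical
  -- The information set is the first r positions of every group. A word vanishing there has at most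
  -- R - r = δ - 1 nonzero symbols in each group, so all its local symbols vanish, and with them the
  -- global ones.
  let g : Fin ℓ × Fin r ↪ Fin n :=
    ⟨fun k => D.place (Sum.inr (k.1, Fin.castLE (by omega) k.2)), fun k k' h => by
      simpa [Prod.ext_iff] using h⟩
  set I : Finset (Fin n) := Finset.univ.map g with hI
  have hIcard : I.card = r * ℓ := by simp [hI, mul_comm]
  have hinj : Function.Injective ((LinearMap.funLeft F F (Subtype.val : I → Fin n)).domRestrict C)
      := by
    rw [← LinearMap.ker_eq_bot, LinearMap.ker_eq_bot']
    rintro ⟨c, hc⟩ hc0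
    have hw := (hC c).1 hc
    refine Subtype.ext (hw.eq_zero fun e => ?_)
    by_contra hne
    have h1 := hw.lt_card_loc hne
    have h2 : (Finset.univ.filter fun i => D.loc c e i ≠ 0).card ≤
        (Finset.univ.filter fun i : Fin R => ¬ (i : ℕ) < r).card := by
      refine Finset.card_le_card fun i hi => ?_
      simp only [Finset.mem_filter, Finset.mem_univ, true_and] at hi ⊢
      intro hir
      exact hi (congrFun hc0 ⟨g (e, ⟨i, hir⟩), Finset.mem_map_of_mem g (Finset.mem_univ _)⟩)
    have h3 := Finset.card_filter_add_card_filter_not (s := (Finset.univ : Finset (Fin R)))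
      (fun i => (i : ℕ) < r)
    have h4 : r ≤ (Finset.univ.filter fun i : Fin R => (i : ℕ) < r).card := by
      calc r = (Finset.univ.map (Fin.castLEEmb (show r ≤ R by omega))).card := by simp
        _ ≤ _ := Finset.card_le_card fun i hi => by
          obtain ⟨j, -, rfl⟩ := Finset.mem_map.1 hi
          simp
    simp only [Finset.card_univ, Fintype.card_fin] at h3
    omega
  have hres : Module.finrank F (restrict C I) = Module.finrank F C := by
    rw [restrict, ← LinearMap.range_domRestrict]
    exact LinearMap.finrank_range_of_inj hinj
  have hk : Module.finrank F C = r * ℓ := by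
    refine le_antisymm ?_ hdim
    rw [← hres]
    refine (Submodule.finrank_le _).trans ?_
    rw [Module.finrank_fintype_fun_eq_card, Fintype.card_coe, hIcard]
  have hpos : 1 ≤ r * ℓ := Nat.mul_pos hr hℓ
  refine ⟨hpos, hk, ⟨?_, ?_⟩, ⟨I, by rw [hIcard, hk], hres, ?_⟩, ?_⟩
  · obtain ⟨c, hc, hc0, hle⟩ := D.exists_isWord_hammingNorm_le hδ hℓ (by omega)
    refine ⟨c, (hC c).2 hc, hc0, ?_⟩
    convert le_antisymm hle (hc.le_hammingNorm hδ hh hcover hc0)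
  · rintro w ⟨c, hc, hc0, rfl⟩
    convert ((hC c).1 hc).le_hammingNorm hδ hh hcover hc0
  · intro a ha
    obtain ⟨k, -, rfl⟩ := Finset.mem_map.1 ha
    exact hasLocality hδ hR.le (fun c hc => (hC c).1 hc) _ _
  -- Here ⌈k / r⌉ = ℓ and n - k = h + ℓ(δ - 1), so the bound equals h + 1 + (δ - 1).
  · have hr0 : (r : ℚ) ≠ 0 := by exact_mod_cast (by omega)
    have : ((r * ℓ : ℕ) : ℚ) / r = ((ℓ : ℤ) : ℚ) := by push_cast; field_simp
    rw [this, Int.ceil_intCast, D.card_eq, hR]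
    have e : ((r + δ - 1 : ℕ) : ℤ) = r + δ - 1 := by push_cast [Nat.sub_add_cancel, show 1 ≤ r + δ by omega]; ring
    push_cast [e]
    ring

end GroupData

end Code


/-! ### The scale of the construction and powers of two up to q. -/

section Width

/-- The square root of the binary logarithm. -/
def width (q : ℕ) : ℕ := Nat.sqrt (Nat.log 2 q)

theorem two_pow_width_sq_le {q : ℕ} (hq : q ≠ 0) : 2 ^ (width q ^ 2) ≤ q :=
  (Nat.pow_le_pow_right two_pos (Nat.sqrt_le' _)).trans (Nat.pow_log_le_self 2 hq)

theorem lt_two_pow_width_sq (q : ℕ) : q < 2 ^ ((width q + 1) ^ 2) :=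
  (Nat.lt_pow_succ_log_self one_lt_two q).trans_le
    (Nat.pow_le_pow_right two_pos (Nat.lt_succ_sqrt' _))

theorem le_width_iff {q t : ℕ} (hq : q ≠ 0) : t ≤ width q ↔ 2 ^ (t ^ 2) ≤ q := by
  rw [width, Nat.le_sqrt', Nat.le_log_iff_pow_le one_lt_two hq]

theorem width_le (q : ℕ) : width q ≤ q := (Nat.sqrt_le_self _).trans (Nat.log_le_self _ _)

theorem tendsto_width : Tendsto width atTop atTop := by
  refine tendsto_atTop.2 fun t => ?_
  filter_upwards [eventually_ge_atTop (2 ^ (t ^ 2))] with q hq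
  have : 0 < 2 ^ (t ^ 2) := by positivity
  exact (le_width_iff (by omega)).2 hq

variable {n : ℕ} {f e : FieldEnum.{u} → (Fin n → ℕ) → ℕ}

theorem PolyTime.width (hf : PolyTime f) : PolyTime (fun Γ x => width (f Γ x)) := by
  -- The width is the number of positive t ≤ q with 2 ^ (t ^ 2) ≤ q; a cut-off at q + 1 does not
  -- affect this comparison.
  refine (PolyTime.sum_range (g := fun Γ i x =>
    if Min.min (2 ^ ((i + 1) ^ 2)) (f Γ x + 1) ≤ f Γ x then 1 else 0) hf
    ((((PolyTime.input 0).succ.pow_const 2).min_two_pow hf.tail.succ).ite_le hf.tail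
      (PolyTime.const 1) (PolyTime.const 0))).of_eq fun Γ x => ?_
  generalize f Γ x = q
  rw [Finset.sum_boole, Nat.cast_id]
  have : Finset.filter (fun i => Min.min (2 ^ ((i + 1) ^ 2)) (q + 1) ≤ q) (Finset.range q) =
      Finset.range (LRC.width q) := by
    ext i
    simp only [Finset.mem_filter, Finset.mem_range, ← Nat.succ_le_iff (m := i) (n := LRC.width q)]
    constructor
    · rintro ⟨h1, h2⟩
      exact (le_width_iff (by omega)).2 (by simpa using h2)
    · intro h
      have h3 := width_le q
      have := (le_width_iff (by omega)).1 h
      exact ⟨by omega, by simpa using this⟩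
  rw [this, Finset.card_range]

theorem min_two_pow_eq {q e : ℕ} (h : e ≤ width q ^ 2) : Min.min (2 ^ e) (q + 1) = 2 ^ e := by
  refine min_eq_left ?_
  rcases eq_or_ne q 0 with rfl | hq
  · have : e = 0 := by simpa [width] using h
    simp [this]
  · have := (Nat.pow_le_pow_right two_pos h).trans (two_pow_width_sq_le hq)
    omega

theorem PolyTime.two_pow (he : PolyTime e) (hf : PolyTime f)
    (h : ∀ Γ x, e Γ x ≤ LRC.width (f Γ x) ^ 2) : PolyTime (fun Γ x => 2 ^ e Γ x) :=
  (he.min_two_pow hf.succ).of_eq fun Γ x => min_two_pow_eq (h Γ x)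

end Width

/-! ### Computing the parameters and the polynomial values. -/

section Parameters

/-- The number of values of the lower coefficients of the polynomials. -/
def coeffRange (q : ℕ) : ℕ := 2 ^ (width q * (width q - 1))

variable (b m : ℕ)

/-- The number of digits used in the leading coefficients of the polynomials. -/
def digitRange (q : ℕ) : ℕ := 2 ^ (width q - b)

/-- The number of local groups of the code over a field with `q` elements. -/
def numBlocks (q : ℕ) : ℕ := coeffRange q ^ m * digitRange b q ^ (width q - 4)

/-- The value at `i` of the polynomial with number `e`. -/
def polyVal (q e i : ℕ) : ℕ :=
  blockVal (coeffRange q) m (2 ^ width q) (digitRange b q) (width q - 4) e i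

variable {b m} {n : ℕ} {f e i : FieldEnum.{u} → (Fin n → ℕ) → ℕ}

theorem PolyTime.coeffRange (hf : PolyTime f) : PolyTime (fun Γ x => coeffRange (f Γ x)) :=
  (hf.width.mul hf.width.pred).two_pow hf fun _ _ => by
    rw [sq]; exact Nat.mul_le_mul_left _ (Nat.sub_le _ _)

theorem PolyTime.digitRange (hf : PolyTime f) : PolyTime (fun Γ x => digitRange b (f Γ x)) :=
  (hf.width.sub (PolyTime.const b)).two_pow hf fun _ _ =>
    (Nat.sub_le _ _).trans (Nat.le_self_pow two_ne_zero _)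

theorem PolyTime.numBlocks (hf : PolyTime f) : PolyTime (fun Γ x => numBlocks b m (f Γ x)) :=
  ((hf.coeffRange.pow_const m).mul
    (((hf.width.sub (PolyTime.const b)).mul (hf.width.sub (PolyTime.const 4))).two_pow hf
      fun Γ x => by rw [sq]; exact Nat.mul_le_mul (Nat.sub_le _ _) (Nat.sub_le _ _))).of_eq
    fun Γ x => by rw [LRC.numBlocks, LRC.digitRange, ← pow_mul]

/-- The powers of the bases are cut off because a summand must be polynomial for every index. For
the indices below `width - 4` that are used, the cut-off has no effect. -/
theorem PolyTime.polyVal (hf : PolyTime f) (he : PolyTime e) (hi : PolyTime i) :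
    PolyTime (fun Γ x => polyVal b m (f Γ x) (e Γ x) (i Γ x)) := by
  have hle : ∀ q i a, i < LRC.width q - 4 → a ≤ LRC.width q → a * i ≤ LRC.width q ^ 2 := by
    intro q i a h h'
    rw [sq]
    exact Nat.mul_le_mul h' (by omega)
  have hy : PolyTime (fun Γ x => e Γ x / LRC.coeffRange (f Γ x) ^ m) :=
    he.div (hf.coeffRange.pow_const m)
  have hs := hf.width.sub (PolyTime.const 4)
  have hw := hf.tail.width
  have hdig : PolyTime (n := n + 1) fun Γ z =>
      (e Γ (fun j => z j.succ) / LRC.coeffRange (f Γ fun j => z j.succ) ^ m) /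
        Min.min (2 ^ ((LRC.width (f Γ fun j => z j.succ) - b) * z 0)) (f Γ (fun j => z j.succ) + 1)
        % LRC.digitRange b (f Γ fun j => z j.succ) :=
    (hy.tail.div (((hw.sub (PolyTime.const b)).mul (PolyTime.input 0)).min_two_pow
      hf.tail.succ)).mod hf.tail.digitRange
  have hpw : PolyTime (n := n + 1) fun Γ z =>
      Min.min (2 ^ (LRC.width (f Γ fun j => z j.succ) * z 0)) (f Γ (fun j => z j.succ) + 1) :=
    (hw.mul (PolyTime.input 0)).min_two_pow hf.tail.succ
  have hlead : PolyTime (fun Γ x => blockLead (LRC.coeffRange (f Γ x)) m (2 ^ LRC.width (f Γ x))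
      (LRC.digitRange b (f Γ x)) (LRC.width (f Γ x) - 4) (e Γ x)) := by
    refine ((PolyTime.sum_range (g := fun Γ i x =>
        (e Γ x / LRC.coeffRange (f Γ x) ^ m) /
          Min.min (2 ^ ((LRC.width (f Γ x) - b) * i)) (f Γ x + 1) % LRC.digitRange b (f Γ x) *
          Min.min (2 ^ (LRC.width (f Γ x) * i)) (f Γ x + 1)) hs (hdig.mul hpw)).add
      ((PolyTime.sum_range (g := fun Γ i x =>
        ((e Γ x / LRC.coeffRange (f Γ x) ^ m) /
          Min.min (2 ^ ((LRC.width (f Γ x) - b) * i)) (f Γ x + 1) % LRC.digitRange b (f Γ x)) ^ 2)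
          hs (hdig.pow_const 2)).mul ((hf.width.mul hs).two_pow hf fun Γ x => by
            rw [sq]; exact Nat.mul_le_mul_left _ (Nat.sub_le _ _)))).of_eq fun Γ x => ?_
    unfold blockLead paraboloid
    congr 1
    · refine Finset.sum_congr rfl fun i hi => ?_
      rw [min_two_pow_eq (hle _ _ _ (Finset.mem_range.1 hi) (Nat.sub_le _ _)),
        min_two_pow_eq (hle _ _ _ (Finset.mem_range.1 hi) le_rfl), digit, LRC.digitRange,
        ← pow_mul, ← pow_mul]
    · rw [← pow_mul]
      congr 1
      refine Finset.sum_congr rfl fun i hi => ?_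
      rw [min_two_pow_eq (hle _ _ _ (Finset.mem_range.1 hi) (Nat.sub_le _ _)), digit,
        LRC.digitRange, ← pow_mul]
  exact (PolyTime.sum_const_range m fun j =>
    ((he.div (hf.coeffRange.pow_const j)).mod hf.coeffRange).mul (hi.pow_const j)).add
    (hlead.mul (hi.pow_const m))

end Parameters

/-! ### The parity-check matrix as an algorithm. -/

section Entries

variable (r δ h : ℕ)

/-- The number of local groups of the code with parameters `r` and `δ`. -/
def groups (q : ℕ) : ℕ := numBlocks ((r + δ - 1) ^ (δ / 2) + 1) (δ / 2) q

/-- The number of vertices in each part of the hypergraph of blocks. -/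
def partSize (q : ℕ) : ℕ := (δ / 2 + 1) * (r + δ - 1) ^ (δ / 2) * coeffRange q

/-- The number of the field element attached to the symbol `i` of the local group `e`. -/
def vertex (q e i : ℕ) : ℕ :=
  h + i * partSize r δ q + polyVal ((r + δ - 1) ^ (δ / 2) + 1) (δ / 2) q e i

/-- The entry of the parity-check matrix for input `(q, a, b)`. -/
noncomputable def checkEntry (Γ : FieldEnum.{u}) (x : Fin 3 → ℕ) : Γ.F :=
  if x 2 < h then
    if x 1 = x 2 then 1 else 0
  else
    if x 1 < h then
      (elt Γ.enum (vertex r δ h (x 0) ((x 2 - h) / (r + δ - 1)) ((x 2 - h) % (r + δ - 1))) -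
        elt Γ.enum (x 1)) ^ (x 0 - 2)
    else
      if (x 1 - h) / (δ - 1) = (x 2 - h) / (r + δ - 1) then
        elt Γ.enum (vertex r δ h (x 0) ((x 2 - h) / (r + δ - 1)) ((x 2 - h) % (r + δ - 1))) ^
          ((x 1 - h) % (δ - 1))
      else 0

theorem fieldPolyTime_checkEntry : FieldPolyTime (checkEntry.{u} r δ h) := by
  have hc : PolyTime (n := 3) fun (_ : FieldEnum.{u}) x => x 2 - h :=
    (PolyTime.input 2).sub (PolyTime.const h)
  have ha : PolyTime (n := 3) fun (_ : FieldEnum.{u}) x => x 1 - h :=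
    (PolyTime.input 1).sub (PolyTime.const h)
  have he := hc.div (PolyTime.const (r + δ - 1))
  have hi := hc.mod (PolyTime.const (r + δ - 1))
  have hx : FieldPolyTime fun (Γ : FieldEnum.{u}) (x : Fin 3 → ℕ) =>
      elt Γ.enum (vertex r δ h (x 0) ((x 2 - h) / (r + δ - 1)) ((x 2 - h) % (r + δ - 1))) :=
    FieldPolyTime.elt (((PolyTime.const h).add (hi.mul
      ((PolyTime.const ((δ / 2 + 1) * (r + δ - 1) ^ (δ / 2))).mul
        (PolyTime.input 0).coeffRange))).add ((PolyTime.input 0).polyVal he hi))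
  exact FieldPolyTime.ite_lt (PolyTime.input 2) (PolyTime.const h)
    (FieldPolyTime.ite_eq (PolyTime.input 1) (PolyTime.input 2) FieldPolyTime.one
      FieldPolyTime.zero)
    (FieldPolyTime.ite_lt (PolyTime.input 1) (PolyTime.const h)
      ((hx.sub (FieldPolyTime.elt (PolyTime.input 1))).pow
        ((PolyTime.input 0).sub (PolyTime.const 2)))
      (FieldPolyTime.ite_eq (ha.div (PolyTime.const (δ - 1))) he
        (hx.pow (ha.mod (PolyTime.const (δ - 1)))) FieldPolyTime.zero))

/-- A matrix that is computed entry by entry in polynomial time is produced by an algorithm. -/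
theorem exists_matrixAlgorithm {rows cols : ℕ → ℕ} {f : (Γ : FieldEnum.{u}) → (Fin 3 → ℕ) → Γ.F}
    (hrows : PolyTime (n := 1) fun (_ : FieldEnum.{u}) x => rows (x 0))
    (hcols : PolyTime (n := 1) fun (_ : FieldEnum.{u}) x => cols (x 0)) (hf : FieldPolyTime f) :
    ∃ (A : MatrixAlgorithm) (K : ℕ), ∀ Γ : FieldEnum.{u},
      A.Valid Γ.enum ∧ A.totalSteps Γ.enum ≤ Γ.q ^ K ∧ A.numRows Γ.enum = rows Γ.q ∧
        A.numCols Γ.enum = cols Γ.q ∧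
        A.matrix Γ.enum = Matrix.of fun (a : Fin (A.numRows Γ.enum)) (b : Fin (A.numCols Γ.enum)) =>
          f Γ ![Γ.q, a, b] := by
  have hrb := hrows.polyBdd
  have hcb := hcols.polyBdd
  obtain ⟨P, hP, hPs⟩ := hrows
  obtain ⟨Q, hQ, hQs⟩ := hcols
  obtain ⟨S, hS, K, hK⟩ := hf
  have hrow : ∀ Γ : FieldEnum.{u},
      MatrixAlgorithm.numRows ⟨P, Q, S⟩ Γ.enum = rows Γ.q := fun Γ => hP Γ _
  have hcol : ∀ Γ : FieldEnum.{u},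
      MatrixAlgorithm.numCols ⟨P, Q, S⟩ Γ.enum = cols Γ.q := fun Γ => hQ Γ _
  obtain ⟨L, hL⟩ := (hPs.add hQs).add
    ((hrb.mul hcb).mul (((PolyBdd.size.add hrb).add hcb).pow K))
  -- A field has q ≥ 2 elements, so the input size 2q + 2 is at most q ^ 3; hence the exponent.
  refine ⟨⟨P, Q, S⟩, 3 * L, fun Γ => ⟨?_, ?_, hrow Γ, hcol Γ, ?_⟩⟩
  · intro a b
    rw [hS]
    exact idx_lt _ _
  · have hq : 2 ≤ Γ.q := by
      by_contra hlt
      have h1 := (Γ.enum.symm 0).isLt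
      have h2 := (Γ.enum.symm 1).isLt
      have h3 : Γ.enum.symm 0 = Γ.enum.symm 1 := Fin.ext (by omega)
      exact zero_ne_one (Γ.enum.symm.injective h3)
    have h1 := hL Γ ![Γ.q]
    have h2 : LRC.size Γ ![Γ.q] ≤ Γ.q ^ 3 := by
      simp only [LRC.size, Fin.sum_univ_one, Matrix.cons_val_zero]
      nlinarith [Nat.mul_le_mul hq hq]
    rw [pow_mul]
    refine le_trans ?_ (h1.trans (Nat.pow_le_pow_left h2 L))
    refine Nat.add_le_add_left ?_ _
    calc _ ≤ ∑ _a : Fin (MatrixAlgorithm.numRows ⟨P, Q, S⟩ Γ.enum),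
          ∑ _b : Fin (MatrixAlgorithm.numCols ⟨P, Q, S⟩ Γ.enum),
            (LRC.size Γ ![Γ.q] + rows Γ.q + cols Γ.q) ^ K := by
          refine Finset.sum_le_sum fun a _ => Finset.sum_le_sum fun b _ => ?_
          refine (hK Γ _).trans (Nat.pow_le_pow_left ?_ K)
          have ha := a.isLt.trans_eq (hrow Γ)
          have hb := b.isLt.trans_eq (hcol Γ)
          simp only [LRC.size, Fin.sum_univ_three, Fin.sum_univ_one, Matrix.cons_val_zero,
            Matrix.cons_val_one, Matrix.cons_val]
          omega
      _ = _ := by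
          simp only [Finset.sum_const, Finset.card_univ, Fintype.card_fin, smul_eq_mul, hrow, hcol]
          simp [mul_assoc]
  · ext a b
    simp only [MatrixAlgorithm.matrix, Matrix.of_apply, hS, elt_idx]

end Entries

/-! ### The matrix defines an optimal code. -/

section Correctness

variable {r δ h q : ℕ}

theorem elt_injOn {F : Type*} [Field F] (enum : Fin q ≃ F) {x y : ℕ} (hx : x < q) (hy : y < q)
    (hxy : elt enum x = elt enum y) : x = y := by
  simpa [elt, hx, hy] using hxy

/-- The budget in powers of 2^w, with w = `width q`, R = r + δ - 1 and m = ⌊δ/2⌋. Since R^m ≤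
2^(R^m), digits below 2^(w - R^m - 1) cause no carries in base 2^w. With w - 4 of them the leading
coefficient is below 2^(w(w-4)) · 2^w · 2^(2w) = 2^(w(w-1)), the range of the lower coefficients;
this explains the 4. The factor 2^w that is left up to 2^(w²) ≤ q absorbs the constants of the R
parts and the h poles. -/
theorem width_bounds (hr : 1 ≤ r) (hδ : 1 ≤ δ)
    (hw : h + (r + δ - 1) * ((δ / 2 + 1) * (r + δ - 1) ^ (δ / 2)) +
      (r + δ - 1) ^ (δ / 2) + 5 ≤ width q) :
    2 * (r + δ - 1) ^ (δ / 2) * digitRange ((r + δ - 1) ^ (δ / 2) + 1) q ≤ 2 ^ width q ∧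
    (∀ e, blockLead (coeffRange q) (δ / 2) (2 ^ width q)
      (digitRange ((r + δ - 1) ^ (δ / 2) + 1) q) (width q - 4) e < coeffRange q) ∧
    h + (r + δ - 1) * partSize r δ q ≤ q := by
  set w := width q with hwdef
  set b := (r + δ - 1) ^ (δ / 2) with hb
  have hb1 : 1 ≤ b := Nat.one_le_pow _ _ (by omega)
  have hq : q ≠ 0 := by
    rintro rfl
    have := width_le 0
    omega
  have h1 : 2 * b * digitRange (b + 1) q ≤ 2 ^ w := by
    unfold digitRange
    calc 2 * b * 2 ^ (w - (b + 1)) ≤ 2 ^ (b + 1) * 2 ^ (w - (b + 1)) := by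
          refine Nat.mul_le_mul_right _ ?_
          rw [pow_succ, mul_comm]
          exact Nat.mul_le_mul_right _ Nat.lt_two_pow_self.le
      _ = 2 ^ w := by rw [← pow_add]; congr 1; omega
  have hd0 : 0 < digitRange (b + 1) q := by unfold digitRange; positivity
  refine ⟨h1, fun e => ?_, ?_⟩
  · refine (blockLead_lt hd0 (by nlinarith)).trans_le ?_
    have h2 : w - 4 + 1 ≤ 2 ^ w := by
      have := (Nat.lt_two_pow_self (n := w))
      omega
    have h3 : digitRange (b + 1) q ^ 2 ≤ 2 ^ (2 * w) := by
      unfold digitRange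
      rw [← pow_mul]
      exact Nat.pow_le_pow_right two_pos (by rw [mul_comm]; exact Nat.mul_le_mul_left _ (Nat.sub_le _ _))
    have h4 : 1 ≤ 2 ^ (2 * w) := Nat.one_le_two_pow
    calc (2 ^ w) ^ (w - 4) * (1 + (w - 4) * digitRange (b + 1) q ^ 2)
        ≤ (2 ^ w) ^ (w - 4) * ((w - 4 + 1) * 2 ^ (2 * w)) := by
          refine Nat.mul_le_mul_left _ ?_
          have := Nat.mul_le_mul_left (w - 4) h3
          linarith
      _ ≤ (2 ^ w) ^ (w - 4) * (2 ^ w * 2 ^ (2 * w)) := by gcongr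
      _ = coeffRange q := by
          rw [coeffRange, ← hwdef, ← pow_mul, ← pow_add, ← pow_add]
          congr 1
          obtain ⟨v, hv⟩ : ∃ v, w = v + 4 := ⟨w - 4, by omega⟩
          rw [hv]
          simp only [Nat.add_sub_cancel, show v + 4 - 1 = v + 3 by omega]
          ring
  · have hM : 1 ≤ coeffRange q := Nat.one_le_two_pow
    calc h + (r + δ - 1) * partSize r δ q
        ≤ h * coeffRange q + (r + δ - 1) * ((δ / 2 + 1) * b) * coeffRange q := by
          have := Nat.mul_le_mul_left h hM
          have e : (r + δ - 1) * partSize r δ q =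
              (r + δ - 1) * ((δ / 2 + 1) * b) * coeffRange q := by
            rw [partSize, ← hb]
            ring
          omega
      _ = (h + (r + δ - 1) * ((δ / 2 + 1) * b)) * coeffRange q := by ring
      _ ≤ 2 ^ w * coeffRange q := by
          refine Nat.mul_le_mul_right _ ?_
          have := (Nat.lt_two_pow_self (n := w))
          omega
      _ = 2 ^ (w ^ 2) := by
          rw [coeffRange, ← hwdef, ← pow_add]
          congr 1
          obtain ⟨v, hv⟩ : ∃ v, w = v + 1 := ⟨w - 1, by omega⟩
          rw [hv, Nat.add_sub_cancel]
          ring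
      _ ≤ q := two_pow_width_sq_le hq

/-- The places `0, …, h - 1` followed by `ℓ` groups of `R` places. -/
def placeEquiv (h ℓ R : ℕ) {n : ℕ} (hn : n = h + ℓ * R) : Fin h ⊕ Fin ℓ × Fin R ≃ Fin n :=
  ((Equiv.sumCongr (Equiv.refl _) finProdFinEquiv).trans finSumFinEquiv).trans (finCongr hn.symm)

theorem placeEquiv_inl {h ℓ R n : ℕ} (hn : n = h + ℓ * R) (j : Fin h) :
    (placeEquiv h ℓ R hn (Sum.inl j) : ℕ) = j := rfl

theorem placeEquiv_inr {h ℓ R n : ℕ} (hn : n = h + ℓ * R) (k : Fin ℓ × Fin R) :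
    (placeEquiv h ℓ R hn (Sum.inr k) : ℕ) = h + (k.2 + R * k.1) := rfl

theorem placeEquiv_inr_div_mod {h ℓ R n : ℕ} (hn : n = h + ℓ * R) (k : Fin ℓ × Fin R) :
    ¬ (placeEquiv h ℓ R hn (Sum.inr k) : ℕ) < h ∧
      ((placeEquiv h ℓ R hn (Sum.inr k) : ℕ) - h) / R = k.1 ∧
      ((placeEquiv h ℓ R hn (Sum.inr k) : ℕ) - h) % R = k.2 := by
  have hlt := k.2.isLt
  rw [placeEquiv_inr, Nat.add_sub_cancel_left, Nat.add_mul_div_left _ _ (by omega),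
    Nat.add_mul_mod_self_left, Nat.div_eq_of_lt hlt, Nat.mod_eq_of_lt hlt]
  omega

/-- The code with the given parity-check matrix is an optimal locally repairable code. -/
theorem isOptimalInfoLRC_checkEntry (Γ : FieldEnum.{u}) (hr : 1 ≤ r) (hδ : 2 ≤ δ) (hh : h ≤ 3 * δ)
    (hw : h + (r + δ - 1) * ((δ / 2 + 1) * (r + δ - 1) ^ (δ / 2)) +
      (r + δ - 1) ^ (δ / 2) + 5 ≤ width Γ.q)
    {rows cols : ℕ} (hrows : rows = h + groups r δ Γ.q * (δ - 1))
    (hcols : cols = h + groups r δ Γ.q * (r + δ - 1)) :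
    IsOptimalInfoLRC (LinearMap.ker (Matrix.of fun (a : Fin rows) (b : Fin cols) =>
      checkEntry r δ h Γ ![Γ.q, a, b]).mulVecLin) (r * groups r δ Γ.q) (h + δ) r δ := by
  classical
  obtain ⟨hd, hlead, hfit⟩ := width_bounds (h := h) hr (by omega : 1 ≤ δ) hw
  set q := Γ.q with hq
  set R := r + δ - 1 with hR
  have hR0 : 0 < R := by omega
  set ℓ := groups r δ q with hℓ
  have hM : 0 < coeffRange q := by unfold coeffRange; positivity
  have hd0 : 0 < digitRange (R ^ (δ / 2) + 1) q := by unfold digitRange; positivity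
  have hℓ0 : 0 < ℓ := by rw [hℓ, groups, numBlocks]; positivity
  have hval : ∀ e i, i < R → polyVal (R ^ (δ / 2) + 1) (δ / 2) q e i < partSize r δ q :=
    fun e i hi => blockVal_lt hM (hlead e) hi
  have hvlt : ∀ e i, i < R → vertex r δ h q e i < q := by
    intro e i hi
    have h1 := hval e i hi
    have h2 : (i + 1) * partSize r δ q ≤ R * partSize r δ q := Nat.mul_le_mul_right _ hi
    rw [add_mul] at h2
    rw [vertex, ← hR]
    omega
  have hq2 : 2 ≤ q := by
    have := width_le q
    omega
  -- Programs have no division, so inverses enter the matrix as powers.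
  have hinv : ∀ x : Γ.F, x ≠ 0 → x ^ (q - 2) = x⁻¹ := by
    intro x hx
    have : Fintype Γ.F := Fintype.ofEquiv _ Γ.enum
    have hcard : Fintype.card Γ.F = q := by
      rw [← Fintype.card_congr Γ.enum, Fintype.card_fin]
    have h1 := FiniteField.pow_card_sub_one_eq_one x hx
    rw [hcard, show q - 1 = q - 2 + 1 by omega, pow_succ] at h1
    exact eq_inv_of_mul_eq_one_left h1
  let D : GroupData Γ.F ℓ R h cols :=
    { point := fun e i => elt Γ.enum (vertex r δ h q e i)
      pole := fun j => elt Γ.enum j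
      place := placeEquiv h ℓ R hcols
      pole_injective := fun j j' hjj => Fin.ext (elt_injOn Γ.enum (by omega) (by omega) hjj)
      point_ne_pole := by
        intro e i j hij
        have := elt_injOn Γ.enum (hvlt e i i.isLt) (by omega) hij
        unfold vertex at this
        omega
      eq_of_point_eq := by
        intro e e' i i' hii
        have h1 := elt_injOn Γ.enum (hvlt e i i.isLt) (hvlt e' i' i'.isLt) hii
        have h2 := hval e i i.isLt
        have h3 := hval e' i' i'.isLt
        unfold vertex at h1
        -- The parts are consecutive intervals after the h numbers of the poles, so division by the
        -- part size recovers the position.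
        have h4 : (polyVal (R ^ (δ / 2) + 1) (δ / 2) q e i + partSize r δ q * i) / partSize r δ q =
            (polyVal (R ^ (δ / 2) + 1) (δ / 2) q e' i' + partSize r δ q * i') / partSize r δ q := by
          congr 1
          linarith
        rw [Nat.add_mul_div_left _ _ (by omega), Nat.add_mul_div_left _ _ (by omega),
          Nat.div_eq_of_lt h2, Nat.div_eq_of_lt h3] at h4
        exact Fin.ext (by omega) }
  refine D.isOptimalInfoLRC hr (by omega) hh hℓ0 hR ?_ ?_ ?_
  · intro E hE hE3 T hT hcov
    refine false_of_blockVal_cover (M := coeffRange q) hδ hR0 hd0 hd le_rfl hE hE3 T hT ?_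
    intro e he i hi
    obtain ⟨e', he', hne, heq⟩ := hcov e he i hi
    refine ⟨e', he', hne, ?_⟩
    have := elt_injOn Γ.enum (hvlt e i i.isLt) (hvlt e' i i.isLt) heq
    unfold vertex at this
    exact Nat.add_left_cancel this
  · intro c
    rw [LinearMap.mem_ker, Matrix.mulVecLin_apply, funext_iff,
      ← (placeEquiv h ℓ (δ - 1) hrows).forall_congr_right]
    have hrow : ∀ a : Fin rows,
        ((Matrix.of fun (a : Fin rows) (b : Fin cols) =>
          checkEntry r δ h Γ ![q, a, b]).mulVec c) a =
        ∑ j : Fin h, (if (a : ℕ) = j then 1 else 0) * D.glob c j + ∑ e, ∑ i,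
          (if (a : ℕ) < h then (D.point e i - elt Γ.enum a) ^ (q - 2) else
            if ((a : ℕ) - h) / (δ - 1) = e then D.point e i ^ (((a : ℕ) - h) % (δ - 1)) else 0) *
            D.loc c e i := by
      intro a
      simp only [Matrix.mulVec, dotProduct, Matrix.of_apply]
      rw [← Equiv.sum_comp (placeEquiv h ℓ R hcols), Fintype.sum_sum_type, Fintype.sum_prod_type]
      congr 1
      · refine Finset.sum_congr rfl fun j _ => ?_
        have hj : (placeEquiv h ℓ R hcols (Sum.inl j) : ℕ) < h := j.isLt
        rw [checkEntry, if_pos (show (![q, a, placeEquiv h ℓ R hcols (Sum.inl j)] : Fin 3 → ℕ) 2 < h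
          from hj)]
        rfl
      · refine Finset.sum_congr rfl fun e _ => Finset.sum_congr rfl fun i _ => ?_
        obtain ⟨h1, h2, h3⟩ := placeEquiv_inr_div_mod hcols (e, i)
        simp only [checkEntry, Matrix.cons_val_zero, Matrix.cons_val_one, Matrix.cons_val, if_neg h1,
          ← hR, h2, h3]
        rfl
    have hinl : ∀ j, ((Matrix.of fun (a : Fin rows) (b : Fin cols) =>
        checkEntry r δ h Γ ![q, a, b]).mulVec c) (placeEquiv h ℓ (δ - 1) hrows (Sum.inl j)) =
        D.glob c j + ∑ e, ∑ i, D.loc c e i * (D.point e i - D.pole j)⁻¹ := by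
      intro j
      rw [hrow, placeEquiv_inl]
      congr 1
      · rw [Finset.sum_eq_single_of_mem j (Finset.mem_univ _), if_pos rfl, one_mul]
        intro j' _ hj
        rw [if_neg fun h => hj (Fin.ext h.symm), zero_mul]
      · refine Finset.sum_congr rfl fun e _ => Finset.sum_congr rfl fun i _ => ?_
        rw [if_pos j.isLt, hinv _ (sub_ne_zero.2 (D.point_ne_pole e i j)), mul_comm]
    have hinr : ∀ e t, ((Matrix.of fun (a : Fin rows) (b : Fin cols) =>
        checkEntry r δ h Γ ![q, a, b]).mulVec c) (placeEquiv h ℓ (δ - 1) hrows (Sum.inr (e, t))) =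
        ∑ i, D.loc c e i * D.point e i ^ (t : ℕ) := by
      intro e t
      obtain ⟨h1, h2, h3⟩ := placeEquiv_inr_div_mod hrows (e, t)
      rw [hrow, h2, h3, Finset.sum_eq_zero, zero_add,
        Finset.sum_eq_single_of_mem e (Finset.mem_univ _)]
      · refine Finset.sum_congr rfl fun i _ => ?_
        rw [if_neg h1, if_pos rfl, mul_comm]
      · intro e' _ he
        refine Finset.sum_eq_zero fun i _ => ?_
        rw [if_neg h1, if_neg fun h => he (Fin.ext h.symm), zero_mul]
      · intro j _
        rw [if_neg, zero_mul]
        intro h'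
        exact h1 (h'.trans_lt j.isLt)
    simp only [Sum.forall, Prod.forall, hinl, hinr, Pi.zero_apply]
    rw [and_comm]
    exact and_congr_left' (forall_congr' fun e =>
      ⟨fun H t ht => H ⟨t, ht⟩, fun H t => H t t.isLt⟩)
  -- Rank and nullity: there are rℓ more columns than rows.
  · have h1 := LinearMap.finrank_range_add_finrank_ker (Matrix.of fun (a : Fin rows)
      (b : Fin cols) => checkEntry r δ h Γ ![q, a, b]).mulVecLin
    have h2 := Submodule.finrank_le (LinearMap.range (Matrix.of fun (a : Fin rows)
      (b : Fin cols) => checkEntry r δ h Γ ![q, a, b]).mulVecLin)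
    rw [Module.finrank_fintype_fun_eq_card, Fintype.card_fin] at h1 h2
    have h3 : h + ℓ * R = h + ℓ * (δ - 1) + r * ℓ := by
      rw [hR, show r + δ - 1 = (δ - 1) + r by omega]
      ring
    omega

end Correctness


/-! ### The length of the code. -/

section Asymptotics

variable (r δ h : ℕ)

/-- The length of the code over a field with `q` elements. -/
def codeLength (q : ℕ) : ℕ := h + groups r δ q * (r + δ - 1)

/-- One formula for both parities of δ: ⌊δ/2⌋ lower coefficients and a leading one, each with
q^(1-o(1)) values. -/
theorem lengthExponent_eq : lengthExponent δ = ((δ / 2 : ℕ) : ℝ) + 1 := by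
  rcases Nat.even_or_odd' δ with ⟨m, rfl | rfl⟩
  · have : 2 * m / 2 = m := by omega
    rw [lengthExponent, if_pos (even_two_mul m), this]
    push_cast
    ring
  · have : (2 * m + 1) / 2 = m := by omega
    rw [lengthExponent, if_neg (by simp), this]
    push_cast
    ring

/-- The difference of the length exponent and the exponent of the length. -/
noncomputable def exponentGap (q : ℕ) : ℝ :=
  lengthExponent δ - Real.log (codeLength r δ h q / (r + δ - 1 : ℕ)) / Real.log q

variable {r δ h}

theorem numBlocks_eq {b m q : ℕ} :
    numBlocks b m q = 2 ^ (width q * (width q - 1) * m + (width q - b) * (width q - 4)) := by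
  rw [numBlocks, coeffRange, digitRange, ← pow_mul, ← pow_mul, ← pow_add]

theorem groups_pos (q : ℕ) : 0 < groups r δ q := by
  rw [groups, numBlocks_eq]
  positivity

theorem codeLength_eq (hR : 0 < r + δ - 1) {q : ℕ} (hq : 2 ≤ q) :
    (codeLength r δ h q : ℝ) =
      ((r + δ - 1 : ℕ) : ℝ) * (q : ℝ) ^ (lengthExponent δ - exponentGap r δ h q) := by
  have hR' : (0 : ℝ) < ((r + δ - 1 : ℕ) : ℝ) := by exact_mod_cast hR
  have hn : (0 : ℝ) < codeLength r δ h q := by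
    have := Nat.mul_pos (groups_pos (r := r) (δ := δ) q) hR
    exact_mod_cast (by unfold codeLength; omega : 0 < codeLength r δ h q)
  have hq' : (1 : ℝ) < q := by exact_mod_cast hq
  rw [exponentGap, sub_sub_cancel, Real.rpow_def_of_pos (by linarith),
    mul_div_cancel₀ _ (Real.log_pos hq').ne', Real.exp_log (by positivity)]
  field_simp

theorem log_numBlocks {b m q : ℕ} (h1 : 1 ≤ width q) (hb : b ≤ width q) (h4 : 4 ≤ width q) :
    Real.log (numBlocks b m q) = (((m : ℝ) + 1) * width q ^ 2 - (m + b + 4) * width q + 4 * b) *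
      Real.log 2 := by
  rw [numBlocks_eq, Nat.cast_pow, Real.log_pow]
  push_cast [Nat.cast_sub h1, Nat.cast_sub hb, Nat.cast_sub h4]
  ring

/-- Both log q and the logarithm of the number of groups, divided by m + 1, are w² log 2 + O(w), and
the h parities contribute at most log (h + 1). Hence the gap is O(1/w); the constant K is a crude
bound for the lower-order terms. -/
theorem tendsto_exponentGap (hR : 0 < r + δ - 1) :
    Tendsto (exponentGap r δ h) atTop (𝓝 0) := by
  set m := δ / 2 with hm
  set b := (r + δ - 1) ^ m + 1 with hb
  set K : ℝ := Real.log (h + 1) + (3 * m + 5 * b + 7) * Real.log 2 with hK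
  have hlim : Tendsto (fun q : ℕ => K * 2 / Real.log 2 / (width q : ℝ)) atTop (𝓝 0) :=
    (tendsto_const_nhds.div_atTop tendsto_natCast_atTop_atTop).comp tendsto_width
  refine squeeze_zero_norm' ?_ hlim
  filter_upwards [tendsto_width.eventually_ge_atTop (b + 4)] with q hw
  have hlog2 : 0 < Real.log 2 := Real.log_pos one_lt_two
  have hR' : (1 : ℝ) ≤ ((r + δ - 1 : ℕ) : ℝ) := by exact_mod_cast hR
  have hw1 : (1 : ℝ) ≤ width q := by exact_mod_cast (by omega : 1 ≤ width q)
  have hq0 : q ≠ 0 := by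
    rintro rfl
    have := width_le 0
    omega
  have hqpos : (0 : ℝ) < q := by exact_mod_cast Nat.pos_of_ne_zero hq0
  set w : ℝ := ((width q : ℕ) : ℝ) with hwdef
  have hqlo : w ^ 2 * Real.log 2 ≤ Real.log q := by
    have : ((2 : ℝ) ^ (width q ^ 2)) ≤ q := by exact_mod_cast two_pow_width_sq_le hq0
    have := Real.log_le_log (by positivity) this
    rwa [Real.log_pow, Nat.cast_pow] at this
  have hqhi : Real.log q ≤ (w + 1) ^ 2 * Real.log 2 := by
    have : (q : ℝ) ≤ 2 ^ ((width q + 1) ^ 2) := by exact_mod_cast (lt_two_pow_width_sq q).le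
    have := Real.log_le_log hqpos this
    rwa [Real.log_pow, Nat.cast_pow, Nat.cast_add, Nat.cast_one] at this
  have hlogq : 0 < Real.log q := lt_of_lt_of_le (by positivity) hqlo
  have hℓ : (1 : ℝ) ≤ groups r δ q := by exact_mod_cast groups_pos q
  have hlo : Real.log (groups r δ q) ≤ Real.log (codeLength r δ h q / (r + δ - 1 : ℕ)) := by
    refine Real.log_le_log (by linarith) ?_
    rw [le_div_iff₀ (by linarith), codeLength]
    push_cast
    linarith [(Nat.cast_nonneg h : (0 : ℝ) ≤ h)]
  have hhi : Real.log (codeLength r δ h q / (r + δ - 1 : ℕ)) ≤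
      Real.log (h + 1) + Real.log (groups r δ q) := by
    rw [← Real.log_mul (by positivity) (by linarith)]
    have hn : (0 : ℝ) < codeLength r δ h q := by
      have := Nat.mul_pos (groups_pos (r := r) (δ := δ) q) hR
      exact_mod_cast (by unfold codeLength; omega : 0 < codeLength r δ h q)
    refine Real.log_le_log (by positivity) ?_
    rw [div_le_iff₀ (by linarith), codeLength]
    push_cast
    have : (h : ℝ) * 1 ≤ h * (groups r δ q * ((r + δ - 1 : ℕ) : ℝ)) :=
      mul_le_mul_of_nonneg_left (by nlinarith) (Nat.cast_nonneg h)
    linarith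
  have hlogl := log_numBlocks (b := b) (m := m) (q := q) (by omega) (by omega) (by omega)
  rw [show numBlocks b m q = groups r δ q from rfl] at hlogl
  rw [hlogl] at hlo hhi
  have hm0 : (0 : ℝ) ≤ m := Nat.cast_nonneg m
  have hb0 : (0 : ℝ) ≤ b := Nat.cast_nonneg b
  have hh0 : 0 ≤ Real.log ((h : ℝ) + 1) :=
    Real.log_nonneg (by linarith [(Nat.cast_nonneg h : (0 : ℝ) ≤ h)])
  set Λ := Real.log (codeLength r δ h q / (r + δ - 1 : ℕ)) with hΛ
  have hnum : |((m : ℝ) + 1) * Real.log q - Λ| ≤ K * 2 * w := by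
    have a1 := mul_le_mul_of_nonneg_left hqlo (by linarith : (0 : ℝ) ≤ m + 1)
    have a2 := mul_le_mul_of_nonneg_left hqhi (by linarith : (0 : ℝ) ≤ m + 1)
    have e1 : 0 ≤ Real.log (h + 1) * (w - 1) := mul_nonneg hh0 (by linarith)
    have e2 : 0 ≤ m * Real.log 2 * (w - 1) := mul_nonneg (by positivity) (by linarith)
    have e3 : 0 ≤ b * Real.log 2 * (w - 1) := mul_nonneg (by positivity) (by linarith)
    have e4 : 0 ≤ Real.log 2 * (w - 1) := mul_nonneg (by positivity) (by linarith)
    have e5 : 0 ≤ m * Real.log 2 := by positivity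
    have e6 : 0 ≤ b * Real.log 2 := by positivity
    rw [abs_le]
    constructor <;> nlinarith
  rw [Real.norm_eq_abs, exponentGap, lengthExponent_eq, ← hm, ← hΛ,
    show (m : ℝ) + 1 - Λ / Real.log q = (((m : ℝ) + 1) * Real.log q - Λ) / Real.log q by
      field_simp, abs_div, abs_of_pos hlogq]
  calc _ ≤ K * 2 * w / (w ^ 2 * Real.log 2) := by gcongr
    _ = _ := by field_simp

end Asymptotics

end LRC

/-- For fixed `r ≥ 1`, `δ ≥ 2` and `2δ + 1 ≤ h ≤ 3δ` there is an algorithm which, for every large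
enough `q` and every field with `q` elements in any enumeration, produces within a number of steps
polynomial in `q` a parity-check matrix of an optimal `[n, k, h + δ; (r, δ)_i]`-LRC with
`n = R q ^ (e - o(1))`, where `R = r + δ - 1` and `e = δ / 2 + 1` for even `δ`,
`e = (δ + 1) / 2` for odd `δ`. -/
theorem corollary5p3 (r δ h : ℕ) (hr : 1 ≤ r) (hδ : 2 ≤ δ)
    (hh₁ : 2 * δ + 1 ≤ h) (hh₂ : h ≤ 3 * δ) :
    ∃ (A : LRC.MatrixAlgorithm) (ε : ℕ → ℝ) (K q₀ : ℕ),
      Tendsto ε atTop (𝓝 0) ∧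
      ∀ q : ℕ, q₀ ≤ q → ∀ (F : Type*) [Field F] (enum : Fin q ≃ F),
        A.Valid enum ∧
        A.totalSteps enum ≤ q ^ K ∧
        (A.numCols enum : ℝ) =
          ((r + δ - 1 : ℕ) : ℝ) * (q : ℝ) ^ (LRC.lengthExponent δ - ε q) ∧
        ∃ k : ℕ, LRC.IsOptimalInfoLRC (A.code enum) k (h + δ) r δ := by
  obtain ⟨A, K, hA⟩ := LRC.exists_matrixAlgorithm
    (rows := fun q => h + LRC.groups r δ q * (δ - 1)) (cols := LRC.codeLength r δ h)
    ((LRC.PolyTime.const h).add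
      ((LRC.PolyTime.input 0).numBlocks.mul (LRC.PolyTime.const (δ - 1))))
    ((LRC.PolyTime.const h).add
      ((LRC.PolyTime.input 0).numBlocks.mul (LRC.PolyTime.const (r + δ - 1))))
    (LRC.fieldPolyTime_checkEntry r δ h)
  obtain ⟨q₀, hq₀⟩ := eventually_atTop.1 (LRC.tendsto_width.eventually_ge_atTop
    (h + (r + δ - 1) * ((δ / 2 + 1) * (r + δ - 1) ^ (δ / 2)) + (r + δ - 1) ^ (δ / 2) + 5))
  refine ⟨A, LRC.exponentGap r δ h, K, max q₀ 2, LRC.tendsto_exponentGap (by omega), ?_⟩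
  intro q hq F _ enum
  obtain ⟨hvalid, hsteps, hrows, hcols, hmat⟩ := hA ⟨q, F, enum⟩
  refine ⟨hvalid, hsteps, ?_, r * LRC.groups r δ q, ?_⟩
  · rw [hcols]
    exact LRC.codeLength_eq (by omega) (le_of_max_le_right hq)
  · have := LRC.isOptimalInfoLRC_checkEntry ⟨q, F, enum⟩ hr hδ hh₂
      (hq₀ q (le_of_max_le_left hq)) hrows hcols
    rw [← hmat] at this
    exact this
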